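/- **Setting.** Let $k,n\ge 1$. Symmetric functions are taken over $\mathbb{Q}$ in the variables $x_1,x_2,\dots$; $\mathrm{m}_\lambda$ and $\mathrm{e}_\lambda$ are the monomial and elementary symmetric functions. Let $\rho_k$ be the linear map with $\rho_k(\mathrm{m}_{\lambda})=\mathrm{m}_{\lambda/k}$ if all parts of $\lambda$ are divisible by $k$, and $\rho_k(\mathrm{m}_\lambda)=0$ otherwise. For $\mu\vdash kn$ the symmetric function $\rho_k(\mathrm{e}_\mu)$ is homogeneous of degree $n$, and $[\mathrm{e}_\nu]\rho_k(\mathrm{e}_\mu)$ denotes its (unique) coefficients in the basis $\{\mathrm{e}_\nu\}_{\nu\vdash n}$. For $0\le i<n$ let $\mathrm{SH}(i)$ be the ribbon skew shape with $kn$ cells whose columns have, from left to right, $k(i+1),k,k,\dots,k$ cells (so there are $n-i$ columns, and the lowest cell of each later column is immediately to the right of the top cell of the column before it). Let $\mathrm{SSYT}(\mathrm{SH}(i),\mu)$ be the set of semistandard fillings (rows weakly increasing, columns strictly increasing downwards) of $\mathrm{SH}(i)$ with $\mu_v$ entries equal to $v$ for all $v\ge1$. Every column is divided into consecutive vertical blocks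 of $k$ cells; the columns after the first one, each a single block, form the upper-right region. *Insertion.* Given $T\in\mathrm{SSYT}(\mathrm{SH}(i+1),\mu)$ and a block $X$ of its first column other than the top one, remove $X$ from the first column (closing the gap) and insert it as a new column of the upper-right region, at the leftmost place (anywhere from directly after the first column to the last position) for which the resulting filling of $\mathrm{SH}(i)$ is semistandard. *Movable blocks.* Let $P\in\mathrm{SSYT}(\mathrm{SH}(i),\mu)$. A block $X$ of the upper-right region of $P$ can be moved back into the first column if it can be taken out of the upper-right region (closing the gap) and put into the first column, at some place below the top block, in such a way that the resulting filling $T$ of $\mathrm{SH}(i+1)$ is semistandard and the insertion procedure, applied to $T$ and the block $X$ in its new place, returns $X$ to the place where it stood in $P$. The tableau $P$ is a *fixed-point block-tableau* if no block of its upper-right region can be moved back into the first column. **Theorem.** Let $k\ge1$, $\mu\vdash kn$ and $1\le r\le n$. Then $$\sum_{\substack{\nu\vdash n\\ \ell(\nu)=r}}[\mathrm{e}_\nu]\,\rho_k(\mathrm{e}_\mu)=\bigl|\{P\in\mathrm{SSYT}(\mathrm{SH}(r-1),\mu): P\text{ is a fixed-point block-tableau}\}\bigr| .$$ In particular, $\sum_{\nu\vdash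 n,\ \ell(\nu)=r}[\mathrm{e}_\nu]\,\rho_k(\mathrm{e}_\mu)\ge 0$. -/

import Mathlib

noncomputable section

namespace SymDiv

/-! ### Symmetric functions, as formal power series over `ℚ` in the variables `x_0, x_1, x_2, …` -/

/-- The monomial symmetric function `m_s`, for `s` a multiset of positive integers (a partition):
the sum of all distinct monomials whose multiset of nonzero exponents is `s`. -/
def mono (s : Multiset ℕ) : MvPowerSeries ℕ ℚ :=
  fun α : ℕ →₀ ℕ => if α.support.val.map α = s then 1 else 0

/-- The elementary symmetric function `e_d`: the sum of all products of `d` distinct variables. -/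
def elem (d : ℕ) : MvPowerSeries ℕ ℚ :=
  fun α : ℕ →₀ ℕ => if (∀ i ∈ α.support, α i = 1) ∧ α.support.card = d then 1 else 0

/-- `e_μ = e_{μ_1} e_{μ_2} ⋯`. -/
def elemPart {N : ℕ} (μ : N.Partition) : MvPowerSeries ℕ ℚ :=
  (μ.parts.map elem).prod

/-- The partition division map `ρ_k`: it keeps the monomials all of whose exponents are divisible
by `k` and divides these exponents by `k`.  For `k ≥ 1` its values on the monomial symmetric
functions are given by `rowMap_mono_map_mul` and `rowMap_mono_of_not_dvd` below. -/
def rowMap (k : ℕ) : MvPowerSeries ℕ ℚ →ₗ[ℚ] MvPowerSeries ℕ ℚ where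
  toFun f := fun α : ℕ →₀ ℕ => MvPowerSeries.coeff (k • α) f
  map_add' f g := by
    funext α
    exact map_add (MvPowerSeries.coeff (k • α)) f g
  map_smul' c f := by
    funext α
    exact map_smul (MvPowerSeries.coeff (k • α)) c f

theorem exponents_smul {k : ℕ} (hk : 1 ≤ k) (α : ℕ →₀ ℕ) :
    (k • α).support.val.map (k • α) = (α.support.val.map α).map (k * ·) := by
  have hs : (k • α).support = α.support := by
    ext i
    simp [Nat.ne_of_gt hk]
  rw [hs, Multiset.map_map]
  exact Multiset.map_congr rfl (fun i _ => by simp)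

/-- `ρ_k (m_{k s}) = m_s`. -/
theorem rowMap_mono_map_mul {k : ℕ} (hk : 1 ≤ k) (s : Multiset ℕ) :
    rowMap k (mono (s.map (k * ·))) = mono s := by
  funext α
  change (if (k • α).support.val.map (k • α) = s.map (k * ·) then (1 : ℚ) else 0)
    = if α.support.val.map α = s then 1 else 0
  rw [exponents_smul hk]
  have hinj : Function.Injective (fun x : ℕ => k * x) :=
    fun a b h => Nat.eq_of_mul_eq_mul_left hk h
  simp only [(Multiset.map_injective hinj).eq_iff]

/-- `ρ_k (m_s) = 0` if some part of `s` is not divisible by `k`. -/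
theorem rowMap_mono_of_not_dvd {k : ℕ} (hk : 1 ≤ k) (s : Multiset ℕ) (h : ¬ ∀ a ∈ s, k ∣ a) :
    rowMap k (mono s) = 0 := by
  funext α
  change (if (k • α).support.val.map (k • α) = s then (1 : ℚ) else 0) = 0
  rw [if_neg]
  intro he
  apply h
  intro a ha
  rw [← he, exponents_smul hk] at ha
  obtain ⟨b, _, rfl⟩ := Multiset.mem_map.1 ha
  exact Dvd.intro b rfl

/-- `c` is a family of coefficients of `f` in the elementary basis of degree `n`:
`f = ∑_{ν ⊢ n} c_ν e_ν`. -/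
def IsElemExpansion {n : ℕ} (f : MvPowerSeries ℕ ℚ) (c : n.Partition → ℚ) : Prop :=
  f = ∑ ν : n.Partition, c ν • elemPart ν

/-! ### Semistandard tableaux on a set of cells -/

/-- A semistandard filling, by positive integers, of a finite set of cells `(row, column)`; rows are
numbered from top to bottom and columns from left to right, starting with `0`. -/
@[ext]
structure SkewSSYT (S : Finset (ℕ × ℕ)) where
  /-- The entry in a given row and column; `0` outside of the shape. -/
  entry : ℕ → ℕ → ℕ
  pos : ∀ {x y}, (x, y) ∈ S → 1 ≤ entry x y
  row_weak : ∀ {x y₁ y₂}, (x, y₁) ∈ S → (x, y₂) ∈ S → y₁ < y₂ → entry x y₁ ≤ entry x y₂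
  col_strict : ∀ {x₁ x₂ y}, (x₁, y) ∈ S → (x₂, y) ∈ S → x₁ < x₂ → entry x₁ y < entry x₂ y
  zeros : ∀ {x y}, (x, y) ∉ S → entry x y = 0

/-- `T` has content `μ`: for each `v` the entry `v + 1` occurs exactly as often as the
`(v + 1)`-st largest part of `μ` says. -/
def SkewSSYT.HasContent {S : Finset (ℕ × ℕ)} (T : SkewSSYT S) {N : ℕ} (μ : N.Partition) : Prop :=
  ∀ v : ℕ, (S.filter (fun x => T.entry x.1 x.2 = v + 1)).card
    = (μ.parts.sort (· ≥ ·)).getD v 0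

/-! ### The ribbon `SH(i)` and its blocks -/

/-- The row of the topmost cell of column `y` of `SH(i)`. -/
def shTop (k n i y : ℕ) : ℕ := (n - 1 - i - y) * (k - 1)

/-- The number of cells of column `y` of `SH(i)`. -/
def shLen (k i y : ℕ) : ℕ := if y = 0 then k * (i + 1) else k

/-- The ribbon `SH(i)`, `0 ≤ i < n`, with columns of lengths `k (i + 1), k, …, k` from left to
right (`n - i` columns, `k n` cells): the lowest cell of each further column lies directly to the
right of the topmost cell of the preceding column. -/
def SH (k n i : ℕ) : Finset (ℕ × ℕ) :=
  (Finset.range (k * n) ×ˢ Finset.range (n - i)).filter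
    (fun x => shTop k n i x.2 ≤ x.1 ∧ x.1 < shTop k n i x.2 + shLen k i x.2)

variable {k n i : ℕ}

/-- The `b`-th `k`-block, from the top, of the first column, read downwards. -/
def firstBlock (T : SkewSSYT (SH k n i)) (b : ℕ) : Fin k → ℕ :=
  fun p => T.entry (shTop k n i 0 + k * b + p) 0

/-- The `k`-blocks of the first column, from top to bottom. -/
def firstBlocks (T : SkewSSYT (SH k n i)) : List (Fin k → ℕ) :=
  List.ofFn (fun b : Fin (i + 1) => firstBlock T b)

/-- The `k`-blocks of the upper-right region, that is the columns after the first one, from left to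
right. -/
def upperBlocks (T : SkewSSYT (SH k n i)) : List (Fin k → ℕ) :=
  List.ofFn (fun j : Fin (n - 1 - i) => fun p : Fin k => T.entry (shTop k n i (j + 1) + p) (j + 1))

/-- The semistandard tableau `P` of shape `SH(i)` is obtained from `T` of shape `SH(i + 1)` by
taking the `b`-th block out of the first column and inserting it as a new column, with exactly `j`
columns of the upper-right region to its left. -/
def PlacedAt (T : SkewSSYT (SH k n (i + 1))) (b j : ℕ) (P : SkewSSYT (SH k n i)) : Prop :=
  firstBlocks P = (firstBlocks T).eraseIdx b ∧
    upperBlocks P = (upperBlocks T).insertIdx j (firstBlock T b)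

/-- `P` is the result of the insertion procedure for the `b`-th block of the first column of `T`:
this block is removed from the first column and inserted into the upper-right region at the
leftmost place at which the resulting filling is semistandard, and this place is the `j`-th. -/
def Reinserts (T : SkewSSYT (SH k n (i + 1))) (b j : ℕ) (P : SkewSSYT (SH k n i)) : Prop :=
  PlacedAt T b j P ∧ ∀ j' < j, ∀ P' : SkewSSYT (SH k n i), ¬ PlacedAt T b j' P'

/-- The `j`-th block of the upper-right region of `P` can be moved into an empty position of the
first column: for some position `b` below the top block, moving it there gives a semistandard
tableau `T`, and this position corresponds to the `j`-th place of the upper-right region, i.e. the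
insertion procedure takes the block from its new position in `T` back to where it stood in `P`. -/
def IsMovable (P : SkewSSYT (SH k n i)) (j : ℕ) : Prop :=
  ∃ (T : SkewSSYT (SH k n (i + 1))) (b : ℕ), 1 ≤ b ∧ b ≤ i + 1 ∧ Reinserts T b j P

/-- `P` is a fixed-point block-tableau: none of its upper-right blocks is movable. -/
def IsFixedPoint (P : SkewSSYT (SH k n i)) : Prop :=
  ∀ j < n - 1 - i, ¬ IsMovable P j

end SymDiv

end

/-! Cut a filling into strictly increasing blocks of `k` cells and write b < c when every entry of b
is smaller than every entry of c. The first column is a chain X of blocks. The row conditions say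
that its top block, followed by the upper-right blocks C, is a word without descents, where a
descent is a block followed by a smaller one. `shuffle` merges X and C into a single word without
descents in which the letters of X carry marks, and each marked letter is a record: it exceeds all
letters before it. Conversely, every set of marked records of a word without descents arises from
exactly one pair.

Let D_m be the generating polynomial of the words of m blocks without descents. Chains of j blocks
are counted by e_{kj}, so the bijection expresses e_{kj} D_m as the sum over words w of length j + m
of binom(rec w, j) x^w. The alternating sum over j vanishes, hence D_m is obtained from the e_{kj}
by the recursion that gives h_m from the e_j.

On the algebraic side, the coefficient of x^α in e_μ and that of x^μ in e_α both count the same 0-1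
matrices (`coeff_prod_elem`). So c expands ρ_k(e_μ) exactly when the functional f ↦ ∑ c_ν [x^ν] f
agrees with [x^μ] on f in the e_d, once every e_d is replaced by e_{kd} (`isElemExpansion_iff`).
That substitution sends e_j h_{n-j} to e_{kj} D_{n-j}. Since [x^ν] e_j h_{n-j} = binom(ℓ(ν), j),
this gives ∑ c_ν binom(ℓ(ν), j) = ∑ binom(rec w, j), over words w of content μ
(`sum_mul_choose_eq`). Binomial inversion then identifies the sum of the c_ν with ℓ(ν) = r with the
number of words having r records.

Finally, moving an upper-right block into the first column amounts to marking an unmarked record,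
and insertion amounts to erasing a mark (`isFixedPoint_iff`). A fixed point is therefore a word with
all of its records marked, which is just a word (`card_fixedPoints`). -/

namespace SymDiv

/-! ### Marked words: merging a chain with a word without descents -/

section MarkedWords

variable {α : Type*} (lt : α → α → Prop)

/-- No letter of the word is smaller than the letter just before it. -/
def NoDescent (w : List α) : Prop := w.IsChain (fun a b => ¬ lt b a)

/-- The marked letters of a word of letters with marks. -/
def marked (l : List (α × Bool)) : List α := (l.filter (fun p => p.2)).map Prod.fst

/-- The letters without a mark of a word of letters with marks. -/
def unmarked (l : List (α × Bool)) : List α := (l.filter (fun p => !p.2)).map Prod.fst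

/-- A word without descents in which each marked letter exceeds all letters before it. -/
structure IsMarkedWord (l : List (α × Bool)) : Prop where
  noDescent : NoDescent lt (l.map Prod.fst)
  record : l.Pairwise (fun p q => q.2 = true → lt p.1 q.1)

@[simp] theorem marked_nil : marked ([] : List (α × Bool)) = [] := rfl
@[simp] theorem unmarked_nil : unmarked ([] : List (α × Bool)) = [] := rfl
@[simp] theorem marked_cons_true (a : α) (l) : marked ((a, true) :: l) = a :: marked l := by
  simp [marked]
@[simp] theorem marked_cons_false (a : α) (l) : marked ((a, false) :: l) = marked l := by
  simp [marked]
@[simp] theorem unmarked_cons_true (a : α) (l) : unmarked ((a, true) :: l) = unmarked l := by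
  simp [unmarked]
@[simp] theorem unmarked_cons_false (a : α) (l) :
    unmarked ((a, false) :: l) = a :: unmarked l := by
  simp [unmarked]
@[simp] theorem marked_append (l l' : List (α × Bool)) :
    marked (l ++ l') = marked l ++ marked l' := by
  simp [marked]
@[simp] theorem unmarked_append (l l' : List (α × Bool)) :
    unmarked (l ++ l') = unmarked l ++ unmarked l' := by
  simp [unmarked]

theorem mem_marked {l : List (α × Bool)} {a : α} : a ∈ marked l ↔ (a, true) ∈ l := by
  simp [marked]

theorem mem_unmarked {l : List (α × Bool)} {a : α} : a ∈ unmarked l ↔ (a, false) ∈ l := by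
  simp [unmarked]

theorem length_marked_add_length_unmarked (l : List (α × Bool)) :
    (marked l).length + (unmarked l).length = l.length := by
  induction l with
  | nil => rfl
  | cons p l ih => rcases p with ⟨a, _ | _⟩ <;> simp <;> omega

theorem perm_marked_append_unmarked (l : List (α × Bool)) :
    (marked l ++ unmarked l).Perm (l.map Prod.fst) := by
  induction l with
  | nil => simp
  | cons p l ih =>
    rcases p with ⟨a, _ | _⟩
    · simpa using List.perm_middle.trans (ih.cons a)
    · simpa using ih

theorem exists_split_at_marked {l : List (α × Bool)} {b : ℕ} (h : b < (marked l).length) :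
    ∃ l₁ l₂, l = l₁ ++ ((marked l)[b], true) :: l₂ ∧ (marked l₁).length = b := by
  induction l generalizing b with
  | nil => simp at h
  | cons p l ih =>
    rcases p with ⟨a, _ | _⟩
    · obtain ⟨l₁, l₂, h₁, h₂⟩ := ih (b := b) (by simpa using h)
      refine ⟨(a, false) :: l₁, l₂, ?_, by simpa using h₂⟩
      simpa using h₁
    · cases b with
      | zero => exact ⟨[], l, by simp, rfl⟩
      | succ b =>
        obtain ⟨l₁, l₂, h₁, h₂⟩ := ih (b := b) (by simpa using h)
        refine ⟨(a, true) :: l₁, l₂, ?_, by simpa using h₂⟩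
        simpa using h₁

variable {lt}

theorem IsMarkedWord.tail {p : α × Bool} {l : List (α × Bool)} (h : IsMarkedWord lt (p :: l)) :
    IsMarkedWord lt l :=
  ⟨(List.isChain_cons.1 h.noDescent).2, (List.pairwise_cons.1 h.record).2⟩

theorem IsMarkedWord.pairwise_marked {l : List (α × Bool)} (h : IsMarkedWord lt l) :
    (marked l).Pairwise lt := by
  rw [marked, List.pairwise_map]
  refine ((h.record.sublist List.filter_sublist).imp_of_mem ?_)
  intro p q _ hq hpq
  exact hpq (by simpa using (List.mem_filter.1 hq).2)

/-- The first unmarked letter after a given letter is not smaller than this letter. -/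
theorem IsMarkedWord.not_lt_head (htr : ∀ a b c, lt a b → lt b c → lt a c)
    {p : α × Bool} {l : List (α × Bool)} (h : IsMarkedWord lt (p :: l)) {c : α}
    (hc : (unmarked l).head? = some c) : ¬ lt c p.1 := by
  induction l generalizing p with
  | nil => simp at hc
  | cons q l ih =>
    have h1 : ¬ lt q.1 p.1 := (List.isChain_cons_cons.1 h.noDescent).1
    rcases q with ⟨a, _ | _⟩
    · simp only [unmarked_cons_false, List.head?_cons, Option.some.injEq] at hc
      exact hc ▸ h1
    · intro hlt
      -- The next letter a is marked and so exceeds p. If c were smaller than p, it would be smaller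
      -- than a as well, which the induction hypothesis excludes.
      refine ih h.tail (by simpa using hc) (htr _ _ _ hlt ?_)
      exact (List.pairwise_cons.1 h.record).1 (a, true) (by simp) rfl

theorem IsMarkedWord.noDescent_unmarked (htr : ∀ a b c, lt a b → lt b c → lt a c)
    {l : List (α × Bool)} (h : IsMarkedWord lt l) : NoDescent lt (unmarked l) := by
  induction l with
  | nil => simp [NoDescent]
  | cons p l ih =>
    rcases p with ⟨a, _ | _⟩
    · rw [unmarked_cons_false, NoDescent, List.isChain_cons]
      exact ⟨fun c hc => h.not_lt_head htr hc, ih h.tail⟩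
    · simpa using ih h.tail

open Classical in
/-- The marked word whose marked letters are `X` and whose other letters are `C`: each letter of
`X` stands as far to the left as possible. -/
noncomputable def shuffle (lt : α → α → Prop) : List α → List α → List (α × Bool)
  | [], C => C.map (fun c => (c, false))
  | x :: X, [] => (x :: X).map (fun x => (x, true))
  | x :: X, c :: C =>
    if lt c x then (c, false) :: shuffle lt (x :: X) C else (x, true) :: shuffle lt X (c :: C)
termination_by X C => X.length + C.length

theorem marked_shuffle (X C : List α) : marked (shuffle lt X C) = X := by
  fun_induction shuffle lt X C <;> simp_all [marked, List.filter_map, Function.comp_def]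

theorem unmarked_shuffle (X C : List α) : unmarked (shuffle lt X C) = C := by
  fun_induction shuffle lt X C <;> simp_all [unmarked, List.filter_map, Function.comp_def]

theorem head?_shuffle {X C : List α} {d : α} (h : ((shuffle lt X C).map Prod.fst).head? = some d) :
    X.head? = some d ∨ C.head? = some d := by
  unfold shuffle at h
  split at h
  · right
    simpa [Function.comp_def] using h
  · left
    simpa using h
  · split_ifs at h
    · right
      simpa using h
    · left
      simpa using h

/-- A letter c precedes the pending x only if c < x, so by transitivity it lies below all remaining
letters of X; this gives the records. No descent is created where the two words meet: c is followed
by a larger x, or x by a letter c that is not smaller. -/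
theorem isMarkedWord_shuffle (has : ∀ a b, lt a b → ¬ lt b a)
    (htr : ∀ a b c, lt a b → lt b c → lt a c) {X C : List α}
    (hX : X.Pairwise lt) (hC : NoDescent lt C) : IsMarkedWord lt (shuffle lt X C) := by
  fun_induction shuffle lt X C with
  | case1 C =>
    refine ⟨by simpa [Function.comp_def] using hC, ?_⟩
    rw [List.pairwise_map]
    exact List.pairwise_of_forall (by simp)
  | case2 x X =>
    refine ⟨?_, ?_⟩
    · rw [List.map_map]
      simpa [NoDescent, Function.comp_def] using (hX.imp (has _ _)).isChain
    · rw [List.pairwise_map]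
      simpa using hX
  | case3 x X c C hcx ih =>
    have ih := ih hX (List.isChain_cons.1 hC).2
    refine ⟨?_, ?_⟩
    · rw [List.map_cons, NoDescent, List.isChain_cons]
      refine ⟨fun d hd => ?_, ih.noDescent⟩
      rcases head?_shuffle hd with h | h
      · simp only [List.head?_cons, Option.some.injEq] at h
        exact h ▸ has _ _ hcx
      · exact (List.isChain_cons.1 hC).1 d h
    · rw [List.pairwise_cons]
      refine ⟨?_, ih.record⟩
      rintro ⟨d, b⟩ hd rfl
      have hd := mem_marked.2 hd
      rw [marked_shuffle] at hd
      rcases List.mem_cons.1 hd with rfl | hd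
      · exact hcx
      · exact htr _ _ _ hcx ((List.pairwise_cons.1 hX).1 d hd)
  | case4 x X c C hcx ih =>
    have ih := ih (List.pairwise_cons.1 hX).2 hC
    refine ⟨?_, ?_⟩
    · rw [List.map_cons, NoDescent, List.isChain_cons]
      refine ⟨fun d hd => ?_, ih.noDescent⟩
      rcases head?_shuffle hd with h | h
      · exact has _ _ ((List.pairwise_cons.1 hX).1 d (List.mem_of_mem_head? h))
      · simp only [List.head?_cons, Option.some.injEq] at h
        exact h ▸ hcx
    · rw [List.pairwise_cons]
      refine ⟨?_, ih.record⟩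
      rintro ⟨d, b⟩ hd rfl
      have hd := mem_marked.2 hd
      rw [marked_shuffle] at hd
      exact (List.pairwise_cons.1 hX).1 d hd

theorem IsMarkedWord.erase_mark {l₁ l₂ : List (α × Bool)} {x : α}
    (h : IsMarkedWord lt (l₁ ++ (x, true) :: l₂)) : IsMarkedWord lt (l₁ ++ (x, false) :: l₂) := by
  refine ⟨by simpa using h.noDescent, ?_⟩
  have := h.record
  simp only [List.pairwise_append, List.pairwise_cons, List.mem_cons] at this ⊢
  grind

theorem IsMarkedWord.add_mark {l₁ l₂ : List (α × Bool)} {x : α}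
    (h : IsMarkedWord lt (l₁ ++ (x, false) :: l₂)) (hx : ∀ p ∈ l₁, lt p.1 x) :
    IsMarkedWord lt (l₁ ++ (x, true) :: l₂) := by
  refine ⟨by simpa using h.noDescent, ?_⟩
  have := h.record
  simp only [List.pairwise_append, List.pairwise_cons, List.mem_cons] at this ⊢
  grind

theorem IsMarkedWord.lt_of_mem {l₁ l₂ : List (α × Bool)} {x : α}
    (h : IsMarkedWord lt (l₁ ++ (x, true) :: l₂)) {p : α × Bool} (hp : p ∈ l₁) : lt p.1 x :=
  (List.pairwise_append.1 h.record).2.2 p hp (x, true) (by simp) rfl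

/-- The comparison made by `shuffle` always picks the actual first letter. If that letter is
unmarked, the next marked letter exceeds it, being a record; if it is marked, the next unmarked
letter is not smaller, by `IsMarkedWord.not_lt_head`. -/
theorem shuffle_marked_unmarked (htr : ∀ a b c, lt a b → lt b c → lt a c)
    {l : List (α × Bool)} (h : IsMarkedWord lt l) :
    shuffle lt (marked l) (unmarked l) = l := by
  induction l with
  | nil => simp [shuffle]
  | cons p l ih =>
    have ih := ih h.tail
    rcases p with ⟨a, _ | _⟩
    · rw [marked_cons_false, unmarked_cons_false]
      rcases hX : marked l with _ | ⟨x, X⟩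
      · rw [hX] at ih
        rw [shuffle] at ih ⊢
        simp [ih]
      · have hx : (x, true) ∈ l := mem_marked.1 (by simp [hX])
        rw [shuffle, if_pos ((List.pairwise_cons.1 h.record).1 _ hx rfl), ← hX, ih]
    · rw [marked_cons_true, unmarked_cons_true]
      rcases hC : unmarked l with _ | ⟨c, C⟩
      · rw [hC] at ih
        rw [shuffle]
        rcases hX : marked l with _ | ⟨x, X⟩ <;> rw [hX] at ih <;> rw [shuffle] at ih <;>
          simpa using ih
      · have := h.not_lt_head htr (c := c) (by simp [hC])
        rw [shuffle, if_neg this, ← hC, ih]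

variable (lt)

open Classical in
/-- The positions of the letters which exceed all letters before them. -/
noncomputable def recordSet (w : List α) : Finset ℕ :=
  (Finset.range w.length).filter
    (fun i => ∀ b, w[i]? = some b → ∀ j < i, ∀ a, w[j]? = some a → lt a b)

theorem lt_length_of_mem_recordSet {w : List α} {i : ℕ} (h : i ∈ recordSet lt w) :
    i < w.length := by
  simp only [recordSet, Finset.mem_filter, Finset.mem_range] at h
  exact h.1

theorem card_recordSet_pos {w : List α} (hw : w ≠ []) : 0 < (recordSet lt w).card := by
  refine Finset.card_pos.2 ⟨0, ?_⟩
  simp only [recordSet, Finset.mem_filter, Finset.mem_range]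
  exact ⟨List.length_pos_iff.2 hw, fun _ _ j hj => absurd hj (by simp)⟩

theorem card_recordSet_le (w : List α) : (recordSet lt w).card ≤ w.length := by
  have h : recordSet lt w ⊆ Finset.range w.length :=
    fun i hi => Finset.mem_range.2 (lt_length_of_mem_recordSet lt hi)
  simpa using Finset.card_le_card h

/-- The positions of the marked letters. -/
def markSet (l : List (α × Bool)) : Finset ℕ :=
  (Finset.range l.length).filter (fun i => l[i]?.map Prod.snd = some true)

/-- The word with marks at the given positions. -/
def setMarks (w : List α) (S : Finset ℕ) : List (α × Bool) :=
  w.mapIdx (fun i a => (a, decide (i ∈ S)))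

theorem map_fst_setMarks (w : List α) (S : Finset ℕ) : (setMarks w S).map Prod.fst = w := by
  apply List.ext_getElem <;> simp [setMarks]

theorem markSet_setMarks {w : List α} {S : Finset ℕ} (hS : ∀ i ∈ S, i < w.length) :
    markSet (setMarks w S) = S := by
  ext i
  rw [markSet, Finset.mem_filter]
  by_cases hi : i < w.length
  · simp [setMarks, hi]
  · have : i ∉ S := fun h => hi (hS i h)
    simp [setMarks, hi, this]

theorem setMarks_markSet (l : List (α × Bool)) : setMarks (l.map Prod.fst) (markSet l) = l := by
  apply List.ext_getElem
  · simp [setMarks]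
  · intro i h₁ h₂
    ext
    · simp [setMarks]
    · simp [setMarks, markSet, h₂]

theorem card_markSet (l : List (α × Bool)) : (markSet l).card = (marked l).length := by
  rw [markSet, Finset.card_filter]
  induction l with
  | nil => rfl
  | cons p l ih =>
    rw [List.length_cons, Finset.sum_range_succ']
    rcases p with ⟨a, _ | _⟩ <;> simp_all

/-- Over a fixed word without descents, the marked words are thus the subsets of its set of records;
this is the source of the binomial coefficients. -/
theorem isMarkedWord_iff {l : List (α × Bool)} :
    IsMarkedWord lt l ↔ NoDescent lt (l.map Prod.fst) ∧
      markSet l ⊆ recordSet lt (l.map Prod.fst) := by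
  constructor
  · intro h
    refine ⟨h.noDescent, fun i hi => ?_⟩
    have hr := List.pairwise_iff_getElem.1 h.record
    simp only [markSet, Finset.mem_filter, Finset.mem_range] at hi
    simp only [recordSet, Finset.mem_filter, Finset.mem_range, List.length_map]
    refine ⟨hi.1, fun b hb j hj a ha => ?_⟩
    have := hr j i (hj.trans hi.1) hi.1 hj
    have h1 := hi.1
    have h2 := hj.trans h1
    simp only [List.getElem?_map, List.getElem?_eq_getElem h1, List.getElem?_eq_getElem h2,
      Option.map_some, Option.some.injEq] at hi hb ha
    rw [← ha, ← hb]
    exact this hi.2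
  · rintro ⟨h, hs⟩
    refine ⟨h, List.pairwise_iff_getElem.2 fun i j hi hj hij hm => ?_⟩
    have : j ∈ markSet l := by simp [markSet, hj, hm]
    have := hs this
    simp only [recordSet, Finset.mem_filter, Finset.mem_range] at this
    exact this.2 _ (by simp [hj]) i hij _ (by simp [hi])

/-- Form in which the fixed-point condition is met later: no unmarked letter is a record. -/
theorem recordSet_subset_markSet_iff {l : List (α × Bool)} :
    recordSet lt (l.map Prod.fst) ⊆ markSet l ↔
      ∀ l₁ x l₂, l = l₁ ++ (x, false) :: l₂ → ¬ ∀ p ∈ l₁, lt p.1 x := by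
  constructor
  · rintro h l₁ x l₂ rfl hx
    have hi : l₁.length ∈ recordSet lt ((l₁ ++ (x, false) :: l₂).map Prod.fst) := by
      simp only [recordSet, Finset.mem_filter, Finset.mem_range]
      refine ⟨by simp, fun b hb j hj a ha => ?_⟩
      simp only [List.map_append, List.map_cons] at ha hb
      rw [List.getElem?_append_left (by simpa using hj)] at ha
      rw [List.getElem?_append_right (by simp)] at hb
      simp only [List.length_map, Nat.sub_self, List.getElem?_cons_zero, Option.some.injEq] at hb
      subst hb
      obtain ⟨p, hp, rfl⟩ := List.mem_map.1 (List.mem_of_getElem? ha)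
      exact hx p hp
    have := h hi
    simp [markSet] at this
  · intro h i hi
    by_contra hm
    have hl : i < l.length := by simpa using lt_length_of_mem_recordSet lt hi
    have hf : (l[i]).2 = false := by
      simpa [markSet, hl] using hm
    refine h (l.take i) (l[i]).1 (l.drop (i + 1)) ?_ ?_
    · rw [← hf]
      simp
    · intro p hp
      obtain ⟨j, hj, rfl⟩ := List.mem_iff_getElem.1 hp
      simp only [recordSet, Finset.mem_filter, Finset.mem_range] at hi
      rw [List.length_take] at hj
      refine hi.2 _ (by simp [hl]) j (by omega) _ ?_
      rw [List.getElem?_map, List.getElem?_eq_getElem (by omega)]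
      simp

end MarkedWords

/-! ### Generating functions of words and their alternating sum -/

section WordSums

open Finset

/-- The words with `n` letters. -/
def wordsOfLength (γ : Type*) [Fintype γ] (n : ℕ) : Finset (List γ) :=
  (Finset.univ : Finset (Fin n → γ)).map ⟨List.ofFn, List.ofFn_injective⟩

theorem mem_wordsOfLength {γ : Type*} [Fintype γ] {n : ℕ} {l : List γ} :
    l ∈ wordsOfLength γ n ↔ l.length = n := by
  simp only [wordsOfLength, mem_map, mem_univ, true_and, Function.Embedding.coeFn_mk]
  constructor
  · rintro ⟨f, rfl⟩
    simp
  · rintro rfl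
    exact ⟨l.get, List.ofFn_get l⟩

variable {β : Type*} [Fintype β] (lt : β → β → Prop)

open Classical in
/-- The increasing words with `n` letters. -/
noncomputable def chainWords (n : ℕ) : Finset (List β) :=
  (wordsOfLength β n).filter (fun w => w.Pairwise lt)

open Classical in
/-- The words with `n` letters and without descents. -/
noncomputable def noDescentWords (n : ℕ) : Finset (List β) :=
  (wordsOfLength β n).filter (NoDescent lt)

open Classical in
/-- The marked words with `j` marked letters and `m` other letters. -/
noncomputable def markedWords (j m : ℕ) : Finset (List (β × Bool)) :=
  (wordsOfLength (β × Bool) (j + m)).filter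
    (fun l => IsMarkedWord lt l ∧ (marked l).length = j)

variable {lt} {A : Type*} [CommSemiring A]

theorem sum_chainWords_mul_sum_noDescentWords (has : ∀ a b, lt a b → ¬ lt b a)
    (htr : ∀ a b c, lt a b → lt b c → lt a c) (wt : β → A) (j m : ℕ) :
    (∑ X ∈ chainWords lt j, (X.map wt).prod) * (∑ C ∈ noDescentWords lt m, (C.map wt).prod)
      = ∑ l ∈ markedWords lt j m, ((l.map Prod.fst).map wt).prod := by
  rw [sum_mul_sum, ← sum_product']
  refine sum_bij' (fun p _ => shuffle lt p.1 p.2) (fun l _ => (marked l, unmarked l))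
    ?_ ?_ ?_ ?_ ?_
  · rintro ⟨X, C⟩ h
    simp only [mem_product, chainWords, noDescentWords, mem_filter, mem_wordsOfLength] at h
    simp only [markedWords, mem_filter, mem_wordsOfLength]
    refine ⟨?_, isMarkedWord_shuffle has htr h.1.2 h.2.2, ?_⟩
    · rw [← length_marked_add_length_unmarked, marked_shuffle, unmarked_shuffle, h.1.1, h.2.1]
    · rw [marked_shuffle, h.1.1]
  · intro l h
    simp only [markedWords, mem_filter, mem_wordsOfLength] at h
    simp only [mem_product, chainWords, noDescentWords, mem_filter, mem_wordsOfLength]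
    have := length_marked_add_length_unmarked l
    exact ⟨⟨h.2.2, h.2.1.pairwise_marked⟩, by omega, h.2.1.noDescent_unmarked htr⟩
  · rintro ⟨X, C⟩ _
    simp [marked_shuffle, unmarked_shuffle]
  · intro l h
    simp only [markedWords, mem_filter, mem_wordsOfLength] at h
    exact shuffle_marked_unmarked htr h.2.1
  · rintro ⟨X, C⟩ _
    rw [← ((perm_marked_append_unmarked (shuffle lt X C)).map wt).prod_eq, marked_shuffle,
      unmarked_shuffle, List.map_append, List.prod_append]

/-- Forget the marks: the fibre over w consists of the j-element subsets of its set of records, and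
the weight depends on w only. -/
theorem sum_markedWords (wt : β → A) (j m : ℕ) :
    ∑ l ∈ markedWords lt j m, ((l.map Prod.fst).map wt).prod
      = ∑ w ∈ noDescentWords lt (j + m), ((recordSet lt w).card.choose j : A) * (w.map wt).prod := by
  classical
  rw [← sum_fiberwise_of_maps_to (s := markedWords lt j m) (t := noDescentWords lt (j + m))
    (g := fun l => l.map Prod.fst)]
  · refine sum_congr rfl fun w hw => ?_
    simp only [noDescentWords, mem_filter, mem_wordsOfLength] at hw
    rw [sum_congr rfl (g := fun _ => (w.map wt).prod)
      (fun l hl => by rw [(mem_filter.1 hl).2]), sum_const, nsmul_eq_mul]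
    congr 2
    rw [← card_powersetCard]
    refine card_bij' (fun l _ => markSet l) (fun S _ => setMarks w S) ?_ ?_ ?_ ?_
    · intro l hl
      simp only [markedWords, mem_filter, mem_wordsOfLength, isMarkedWord_iff] at hl
      rw [mem_powersetCard, card_markSet, ← hl.2]
      exact ⟨hl.1.2.1.2, hl.1.2.2⟩
    · intro S hS
      rw [mem_powersetCard] at hS
      have hm : markSet (setMarks w S) = S :=
        markSet_setMarks fun i hi => lt_length_of_mem_recordSet lt (hS.1 hi)
      simp only [markedWords, mem_filter, mem_wordsOfLength, isMarkedWord_iff, map_fst_setMarks,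
        ← card_markSet, hm, hS.2, hS.1, hw.2, and_self, and_true]
      simpa [setMarks] using hw.1
    · intro l hl
      rw [← (mem_filter.1 hl).2, setMarks_markSet]
    · intro S hS
      rw [mem_powersetCard] at hS
      exact markSet_setMarks fun i hi => lt_length_of_mem_recordSet lt (hS.1 hi)
  · intro l hl
    simp only [markedWords, mem_filter, mem_wordsOfLength] at hl
    simp only [noDescentWords, mem_filter, mem_wordsOfLength]
    exact ⟨by simpa using hl.1, hl.2.1.noDescent⟩

theorem sum_neg_one_pow_mul_choose_eq_zero {a n : ℕ} (ha : 0 < a) (han : a ≤ n)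
    (A : Type*) [CommRing A] :
    ∑ j ∈ range (n + 1), (-1 : A) ^ j * (a.choose j : A) = 0 := by
  have h : ∑ j ∈ range (n + 1), (-1 : ℤ) ^ j * (a.choose j : ℤ) = 0 := by
    rw [← Int.alternating_sum_range_choose_of_ne ha.ne']
    -- The summands with j > a vanish, so the sum up to n is the alternating sum of a full row of
    -- binomial coefficients.
    refine (sum_subset (range_mono (by omega)) fun j _ hj => ?_).symm
    rw [Nat.choose_eq_zero_of_lt (by simpa using hj)]
    simp
  simpa using congrArg (Int.cast : ℤ → A) h

/-- Each word w contributes the alternating sum of binom(rec w, j). This is zero because the first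
letter of a nonempty word is always a record. -/
theorem sum_neg_one_pow_mul_noDescentWords {A : Type*} [CommRing A]
    (has : ∀ a b, lt a b → ¬ lt b a)
    (htr : ∀ a b c, lt a b → lt b c → lt a c) (wt : β → A) {n : ℕ} (hn : 0 < n) :
    ∑ j ∈ range (n + 1), (-1 : A) ^ j * ((∑ X ∈ chainWords lt j, (X.map wt).prod) *
      (∑ C ∈ noDescentWords lt (n - j), (C.map wt).prod)) = 0 := by
  have : ∀ j ∈ range (n + 1), (-1 : A) ^ j * ((∑ X ∈ chainWords lt j, (X.map wt).prod) *
      (∑ C ∈ noDescentWords lt (n - j), (C.map wt).prod)) =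
      ∑ w ∈ noDescentWords lt n,
        (-1 : A) ^ j * ((recordSet lt w).card.choose j : A) * (w.map wt).prod := by
    intro j hj
    rw [sum_chainWords_mul_sum_noDescentWords has htr, sum_markedWords, mul_sum,
      Nat.add_sub_cancel' (by simpa [Nat.lt_succ_iff] using hj)]
    simp only [mul_assoc]
  rw [sum_congr rfl this, sum_comm]
  refine sum_eq_zero fun w hw => ?_
  simp only [noDescentWords, mem_filter, mem_wordsOfLength] at hw
  rw [← sum_mul, sum_neg_one_pow_mul_choose_eq_zero (card_recordSet_pos lt _)
    (hw.1 ▸ card_recordSet_le lt w), zero_mul]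
  rintro rfl
  simp at hw
  omega

end WordSums

/-! ### Words of `k`-blocks and elementary symmetric polynomials -/

section Blocks

open Finset MvPolynomial

/-- All entries of the first block are smaller than all entries of the second one. -/
def BlockLT {k : ℕ} {γ : Type*} [LT γ] (b c : Fin k → γ) : Prop := ∀ p q, b p < c q

theorem BlockLT.not_symm {k : ℕ} (hk : 1 ≤ k) {γ : Type*} [Preorder γ] {b c : Fin k → γ}
    (h : BlockLT b c) : ¬ BlockLT c b :=
  fun h' => lt_asymm (h ⟨0, hk⟩ ⟨0, hk⟩) (h' ⟨0, hk⟩ ⟨0, hk⟩)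

theorem BlockLT.trans {k : ℕ} (hk : 1 ≤ k) {γ : Type*} [Preorder γ] {a b c : Fin k → γ}
    (h : BlockLT a b) (h' : BlockLT b c) : BlockLT a c :=
  fun p q => (h p ⟨0, hk⟩).trans (h' ⟨0, hk⟩ q)

/-- The order `BlockLT` on strictly increasing blocks of `k` letters. -/
def SortedBlockLT (k N : ℕ) (b c : Fin k ↪o Fin N) : Prop := BlockLT (b : Fin k → Fin N) c

/-- The monomial of a strictly increasing block. -/
noncomputable def blockWeight {k N : ℕ} (b : Fin k ↪o Fin N) : MvPolynomial (Fin N) ℚ :=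
  ∏ p, X (b p)

variable {k N j : ℕ}

theorem SortedBlockLT.not_symm (hk : 1 ≤ k) (b c : Fin k ↪o Fin N)
    (h : SortedBlockLT k N b c) : ¬ SortedBlockLT k N c b :=
  BlockLT.not_symm hk h

theorem SortedBlockLT.trans (hk : 1 ≤ k) (a b c : Fin k ↪o Fin N)
    (h : SortedBlockLT k N a b) (h' : SortedBlockLT k N b c) : SortedBlockLT k N a c :=
  BlockLT.trans hk h h'

/-- The concatenation of `j` blocks. -/
def concatBlocks (f : Fin j → Fin k ↪o Fin N) (t : Fin (j * k)) : Fin N := f t.divNat t.modNat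

theorem concatBlocks_finProdFinEquiv (f : Fin j → Fin k ↪o Fin N) (a : Fin j) (p : Fin k) :
    concatBlocks f (finProdFinEquiv (a, p)) = f a p := by
  have := finProdFinEquiv.symm_apply_apply (a, p)
  rw [finProdFinEquiv_symm_apply, Prod.mk.injEq] at this
  rw [concatBlocks, this.1, this.2]

theorem strictMono_concatBlocks {f : Fin j → Fin k ↪o Fin N}
    (hf : ∀ a b, a < b → SortedBlockLT k N (f a) (f b)) : StrictMono (concatBlocks f) := by
  intro s t hst
  obtain ⟨⟨a, p⟩, rfl⟩ := finProdFinEquiv.surjective s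
  obtain ⟨⟨b, q⟩, rfl⟩ := finProdFinEquiv.surjective t
  rw [concatBlocks_finProdFinEquiv, concatBlocks_finProdFinEquiv]
  simp only [Fin.lt_def, finProdFinEquiv_apply_val] at hst
  rcases lt_trichotomy a b with hab | rfl | hab
  · exact hf a b hab p q
  · exact (f a).strictMono (Fin.lt_def.2 (by omega))
  · exfalso
    have h1 : k * (b + 1 : ℕ) ≤ k * a := Nat.mul_le_mul_left k hab
    have := q.2
    rw [mul_add, mul_one] at h1
    omega

/-- Concatenating a chain of j blocks gives a strictly increasing sequence of kj letters, that is a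
kj-element set; conversely, the increasing enumeration of such a set is cut into pieces of length k.
-/
theorem sum_chainWords_blockWeight (k N j : ℕ) :
    ∑ w ∈ chainWords (SortedBlockLT k N) j, (w.map blockWeight).prod
      = esymm (Fin N) ℚ (k * j) := by
  classical
  rw [esymm, chainWords, wordsOfLength, filter_map, sum_map]
  refine sum_bij (fun f _ => univ.image (concatBlocks f)) ?_ ?_ ?_ ?_
  · intro f hf
    simp only [mem_filter, mem_univ, true_and, Function.comp_apply, Function.Embedding.coeFn_mk,
      List.pairwise_ofFn] at hf
    rw [mem_powersetCard_univ, card_image_of_injective _ (strictMono_concatBlocks hf).injective]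
    simp [mul_comm]
  · intro f hf g hg hfg
    simp only [mem_filter, mem_univ, true_and, Function.comp_apply, Function.Embedding.coeFn_mk,
      List.pairwise_ofFn] at hf hg
    have hc : (univ.image (concatBlocks f)).card = j * k := by
      rw [card_image_of_injective _ (strictMono_concatBlocks hf).injective]
      simp
    -- A finite set has only one increasing enumeration, so equal images force equal concatenations.
    have h1 := orderEmbOfFin_unique hc (fun x => mem_image_of_mem _ (mem_univ x))
      (strictMono_concatBlocks hf)
    have h2 := orderEmbOfFin_unique hc
      (fun x => hfg ▸ mem_image_of_mem _ (mem_univ x)) (strictMono_concatBlocks hg)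
    funext a
    ext p : 1
    rw [← concatBlocks_finProdFinEquiv, ← concatBlocks_finProdFinEquiv, h2, ← h1]
  · intro S hS
    have hc : S.card = j * k := by
      rw [mem_powersetCard_univ.1 hS, mul_comm]
    let f : Fin j → Fin k ↪o Fin N := fun a => OrderEmbedding.ofStrictMono
      (fun p => S.orderEmbOfFin hc (finProdFinEquiv (a, p))) (by
        intro p q hpq
        refine (S.orderEmbOfFin hc).strictMono ?_
        simp only [Fin.lt_def, finProdFinEquiv_apply_val]
        have := Fin.lt_def.1 hpq
        omega)
    have he : concatBlocks f = S.orderEmbOfFin hc := by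
      funext t
      obtain ⟨⟨a, p⟩, rfl⟩ := finProdFinEquiv.surjective t
      rw [concatBlocks_finProdFinEquiv]
      rfl
    refine ⟨f, ?_, ?_⟩
    · simp only [mem_filter, mem_univ, true_and, Function.comp_apply,
        Function.Embedding.coeFn_mk, List.pairwise_ofFn]
      intro a b hab p q
      refine (S.orderEmbOfFin hc).strictMono ?_
      simp only [Fin.lt_def, finProdFinEquiv_apply_val]
      have h1 : k * (a + 1 : ℕ) ≤ k * b := Nat.mul_le_mul_left k hab
      have := p.2
      rw [mul_add, mul_one] at h1
      omega
    · rw [he, ← Finset.coe_inj, coe_image, coe_univ, Set.image_univ, range_orderEmbOfFin]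
  · intro f hf
    simp only [mem_filter, mem_univ, true_and, Function.comp_apply, Function.Embedding.coeFn_mk,
      List.pairwise_ofFn] at hf
    rw [prod_image (strictMono_concatBlocks hf).injective.injOn,
      ← finProdFinEquiv.prod_comp, Fintype.prod_prod_type]
    simp only [Function.Embedding.coeFn_mk, List.map_ofFn, List.prod_ofFn, Function.comp_apply,
      blockWeight, concatBlocks_finProdFinEquiv]

/-- The generating polynomial of the words without descents of `m` blocks of `k` letters. -/
noncomputable def noDescentSum (k N m : ℕ) : MvPolynomial (Fin N) ℚ :=
  ∑ w ∈ noDescentWords (SortedBlockLT k N) m, (w.map blockWeight).prod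

theorem esymm_mul_noDescentSum (hk : 1 ≤ k) (N j m : ℕ) :
    esymm (Fin N) ℚ (k * j) * noDescentSum k N m
      = ∑ w ∈ noDescentWords (SortedBlockLT k N) (j + m),
        ((recordSet (SortedBlockLT k N) w).card.choose j : MvPolynomial (Fin N) ℚ) *
          (w.map blockWeight).prod := by
  rw [← sum_chainWords_blockWeight, noDescentSum, sum_chainWords_mul_sum_noDescentWords
    (SortedBlockLT.not_symm hk) (SortedBlockLT.trans hk),
    sum_markedWords]

/-- The analogue for e_{kj} of the relation between the e_j and the h_m; it determines
`noDescentSum` recursively. -/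
theorem sum_neg_one_pow_mul_esymm_mul_noDescentSum (hk : 1 ≤ k) (N : ℕ) {n : ℕ} (hn : 0 < n) :
    ∑ j ∈ range (n + 1), (-1) ^ j * (esymm (Fin N) ℚ (k * j) * noDescentSum k N (n - j)) = 0 := by
  simp only [← sum_chainWords_blockWeight, noDescentSum]
  exact sum_neg_one_pow_mul_noDescentWords (SortedBlockLT.not_symm hk)
    (SortedBlockLT.trans hk) _ hn

theorem noDescentSum_zero (k N : ℕ) : noDescentSum k N 0 = 1 := by
  classical
  have : noDescentWords (SortedBlockLT k N) 0 = {[]} := by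
    ext w
    simp only [noDescentWords, mem_filter, mem_wordsOfLength, List.length_eq_zero_iff,
      mem_singleton]
    exact ⟨fun h => h.1, fun h => ⟨h, by simp [h, NoDescent]⟩⟩
  rw [noDescentSum, this]
  simp

/-- The number of times each letter occurs in a word of blocks. -/
noncomputable def wordContent (w : List (Fin k ↪o Fin N)) : Fin N →₀ ℕ :=
  (w.map (fun b => ∑ p, Finsupp.single (b p) 1)).sum

theorem prod_blockWeight (w : List (Fin k ↪o Fin N)) :
    (w.map blockWeight).prod = monomial (wordContent w) 1 := by
  induction w with
  | nil => simp [wordContent]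
  | cons b w ih =>
    have h : wordContent (b :: w) = (∑ p, Finsupp.single (b p) 1) + wordContent w := rfl
    rw [List.map_cons, List.prod_cons, ih, h,
      ← one_mul (1 : ℚ), ← monomial_mul, one_mul, blockWeight]
    congr 1
    rw [monomial_sum_one]
    rfl

open Classical in
theorem coeff_esymm_mul_noDescentSum (hk : 1 ≤ k) (N j m : ℕ) (γ : Fin N →₀ ℕ) :
    coeff γ (esymm (Fin N) ℚ (k * j) * noDescentSum k N m)
      = ∑ w ∈ noDescentWords (SortedBlockLT k N) (j + m) with wordContent w = γ,
        ((recordSet (SortedBlockLT k N) w).card.choose j : ℚ) := by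
  rw [esymm_mul_noDescentSum hk, coeff_sum, sum_filter]
  refine sum_congr rfl fun w _ => ?_
  rw [prod_blockWeight, ← map_natCast (C (σ := Fin N) (R := ℚ)), coeff_C_mul, coeff_monomial]
  simp

end Blocks

/-! ### Complete homogeneous polynomials -/

section Complete

open Finset MvPolynomial

/-- The complete homogeneous symmetric polynomial, as the sum of all monomials of degree `m`. -/
noncomputable def completeSum (N m : ℕ) : MvPolynomial (Fin N) ℚ :=
  ∑ γ ∈ finsuppAntidiag univ m, monomial γ 1

theorem completeSum_zero (N : ℕ) : completeSum N 0 = 1 := by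
  simp [completeSum]

theorem coeff_completeSum {N m : ℕ} (γ : Fin N →₀ ℕ) :
    coeff γ (completeSum N m) = if γ.degree = m then 1 else 0 := by
  rw [completeSum, coeff_sum]
  simp [coeff_monomial, mem_finsuppAntidiag, Finsupp.degree_eq_sum]

/-- To produce x^γ, choose j of the variables dividing it for the factor from e_j; the quotient is
then a single monomial, which occurs in h_m exactly when the degrees match. -/
theorem coeff_esymm_mul_completeSum {N : ℕ} (γ : Fin N →₀ ℕ) (j m : ℕ) :
    coeff γ (esymm (Fin N) ℚ j * completeSum N m)
      = if γ.degree = j + m then (γ.support.card.choose j : ℚ) else 0 := by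
  rw [esymm_eq_sum_monomial, sum_mul, coeff_sum]
  simp only [coeff_monomial_mul', coeff_completeSum, one_mul]
  have : ∀ S ∈ powersetCard j (univ : Finset (Fin N)),
      (if (∑ i ∈ S, Finsupp.single i 1) ≤ γ then
        (if (γ - ∑ i ∈ S, Finsupp.single i 1).degree = m then (1 : ℚ) else 0) else 0)
      = if S ⊆ γ.support then (if γ.degree = j + m then 1 else 0) else 0 := by
    intro S hS
    have hv : ∀ v, (∑ i ∈ S, Finsupp.single i 1 : Fin N →₀ ℕ) v = if v ∈ S then 1 else 0 := by
      intro v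
      simp [Finsupp.finsetSum_apply, Finsupp.single_apply]
    have hle : (∑ i ∈ S, Finsupp.single i 1) ≤ γ ↔ S ⊆ γ.support := by
      rw [Finsupp.le_def]
      refine ⟨fun h v hv' => ?_, fun h v => ?_⟩
      · have := h v
        rw [hv, if_pos hv'] at this
        exact Finsupp.mem_support_iff.2 (by omega)
      · rw [hv]
        split_ifs with hv'
        · exact Nat.one_le_iff_ne_zero.2 (Finsupp.mem_support_iff.1 (h hv'))
        · exact Nat.zero_le _
    simp only [hle]
    split_ifs with h h1 h2 h2 <;> try rfl
    all_goals
      exfalso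
      have h3 := congrArg Finsupp.degree (tsub_add_cancel_of_le (hle.2 h))
      rw [map_add, map_sum] at h3
      simp only [Finsupp.degree_single, sum_const, (mem_powersetCard.1 hS).2] at h3
      simp at h3
      omega
  rw [sum_congr rfl this, ← sum_filter, sum_const]
  have : (powersetCard j (univ : Finset (Fin N))).filter (· ⊆ γ.support)
      = powersetCard j γ.support := by
    ext S
    simp [mem_powersetCard, and_comm]
  rw [this, card_powersetCard]
  simp

theorem sum_neg_one_pow_mul_esymm_mul_completeSum (N : ℕ) {n : ℕ} (hn : 0 < n) :
    ∑ j ∈ range (n + 1), (-1) ^ j * (esymm (Fin N) ℚ j * completeSum N (n - j)) = 0 := by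
  ext γ
  rw [coeff_sum, coeff_zero]
  have : ∀ j ∈ range (n + 1),
      coeff γ ((-1) ^ j * (esymm (Fin N) ℚ j * completeSum N (n - j)))
        = if γ.degree = n then (-1) ^ j * (γ.support.card.choose j : ℚ) else 0 := by
    intro j hj
    rw [show ((-1) ^ j : MvPolynomial (Fin N) ℚ) = C ((-1) ^ j) by simp, coeff_C_mul,
      coeff_esymm_mul_completeSum, Nat.add_sub_cancel' (by simpa [Nat.lt_succ_iff] using hj)]
    simp
  rw [sum_congr rfl this]
  split_ifs with h
  · refine sum_neg_one_pow_mul_choose_eq_zero ?_ ?_ ℚ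
    · rw [card_pos, Finsupp.support_nonempty_iff]
      rintro rfl
      simp at h
      omega
    · rw [← h, Finsupp.degree_apply, card_eq_sum_ones]
      exact sum_le_sum fun i hi => Nat.one_le_iff_ne_zero.2 (Finsupp.mem_support_iff.1 hi)
  · simp

end Complete

/-! ### Duality of coefficients through 0-1 matrices -/

section Duality

open Finset

theorem coeff_elem (d : ℕ) (α : ℕ →₀ ℕ) : MvPowerSeries.coeff α (elem d)
    = if (∀ i ∈ α.support, α i = 1) ∧ α.support.card = d then 1 else 0 := rfl

/-- Expanding the product selects a set of variables from each factor, which is a 0-1 matrix with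
prescribed row and column sums. -/
theorem coeff_prod_esymm {ι κ : Type*} [Fintype ι] [Fintype κ] [DecidableEq ι] [DecidableEq κ]
    (a : κ → ℕ) (b : ι →₀ ℕ) :
    MvPolynomial.coeff b (∏ i, MvPolynomial.esymm ι ℚ (a i))
      = ((univ.filter (fun M : κ → Finset ι =>
          (∀ i, (M i).card = a i) ∧ ∀ v, (univ.filter (fun i => v ∈ M i)).card = b v)).card : ℚ) := by
  simp only [MvPolynomial.esymm_eq_sum_monomial]
  rw [prod_univ_sum, MvPolynomial.coeff_sum]
  simp only [← MvPolynomial.monomial_sum_one, MvPolynomial.coeff_monomial]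
  rw [← sum_filter, sum_const, nsmul_eq_mul, mul_one]
  congr 2
  ext M
  simp only [mem_filter, Fintype.mem_piFinset, mem_powersetCard_univ, mem_univ, true_and]
  refine and_congr_right fun _ => ?_
  rw [Finsupp.ext_iff]
  refine forall_congr' fun v => ?_
  simp [Finsupp.finsetSum_apply, Finsupp.single_apply]

open Classical in
theorem exists_vec_of_relation {ι : Type*} [Finite ι] (s : Finset ℕ) (P : ι → s → Prop) :
    ∃ l : ι →₀ ℕ →₀ ℕ, ∀ v i, l v i = if ∃ h : i ∈ s, P v ⟨i, h⟩ then 1 else 0 :=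
  ⟨Finsupp.equivFunOnFinite.symm fun v => Finsupp.onFinset s
    (fun i => if ∃ h : i ∈ s, P v ⟨i, h⟩ then 1 else 0)
    (fun _ hi => by_contra fun h => hi (if_neg fun h' => h h'.1)), fun _ _ => rfl⟩

theorem sum_boole_mem {ι : Type*} [Fintype ι] [DecidableEq ι] (s : Finset ι) :
    ∑ v, (if v ∈ s then 1 else 0) = s.card := by
  simp

/-- Both sides count 0-1 matrices with margins α and b, read along rows on one side and along
columns on the other. Restricting to the support of α loses nothing, as the other columns are zero.
-/
theorem coeff_prod_elem {ι : Type*} [Fintype ι] [DecidableEq ι] (α : ℕ →₀ ℕ) (b : ι →₀ ℕ) :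
    MvPowerSeries.coeff α (∏ v, elem (b v))
      = MvPolynomial.coeff b (∏ i : α.support, MvPolynomial.esymm ι ℚ (α i)) := by
  classical
  rw [coeff_prod_esymm, MvPowerSeries.coeff_prod]
  simp only [coeff_elem, prod_boole, mem_univ, true_imp_iff]
  rw [sum_boole]
  congr 1
  let M : (ι →₀ ℕ →₀ ℕ) → α.support → Finset ι := fun l i => univ.filter (fun v => l v i = 1)
  have hval : ∀ l : ι →₀ ℕ →₀ ℕ, (∀ v, (∀ i ∈ (l v).support, l v i = 1)) →
      ∀ v i, l v i = if l v i = 1 then 1 else 0 := by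
    intro l hl v i
    by_cases h : l v i = 0
    · simp [h]
    · simp [hl v i (Finsupp.mem_support_iff.2 h)]
  have hsum : ∀ l : ι →₀ ℕ →₀ ℕ, l ∈ finsuppAntidiag univ α ↔ ∀ i, ∑ v, l v i = α i := by
    intro l
    simp [mem_finsuppAntidiag, Finsupp.ext_iff, Finsupp.finsetSum_apply]
  have hsub : ∀ l : ι →₀ ℕ →₀ ℕ, l ∈ finsuppAntidiag univ α →
      ∀ v i, i ∉ α.support → l v i = 0 := by
    intro l hl v i hi
    have h1 := (hsum l).1 hl i
    rw [Finsupp.notMem_support_iff.1 hi, sum_eq_zero_iff] at h1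
    exact h1 v (mem_univ v)
  refine card_bij (fun l _ => M l) ?_ ?_ ?_
  · intro l hl
    simp only [mem_filter] at hl
    obtain ⟨hl, hb⟩ := hl
    have h01 := hval l fun v => (hb v).1
    simp only [mem_filter, mem_univ, true_and, M]
    constructor
    · intro i
      rw [card_filter, ← (hsum l).1 hl i]
      exact sum_congr rfl fun v _ => (h01 v i).symm
    · intro v
      rw [← (hb v).2, ← card_map (Function.Embedding.subtype _)]
      congr 1
      ext i
      simp only [mem_map, mem_filter, mem_univ, true_and, Function.Embedding.subtype_apply,
        Subtype.exists, exists_and_right, exists_eq_right]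
      constructor
      · rintro ⟨_, h⟩
        exact Finsupp.mem_support_iff.2 (by omega)
      · intro h
        refine ⟨by_contra fun hi => ?_, (hb v).1 i h⟩
        exact Finsupp.mem_support_iff.1 h (hsub l hl v i hi)
  · intro l hl l' hl' h
    simp only [mem_filter] at hl hl'
    ext v i
    by_cases hi : i ∈ α.support
    · have h1 := Finset.ext_iff.1 (congrFun h ⟨i, hi⟩) v
      simp only [M, mem_filter, mem_univ, true_and] at h1
      rw [hval l (fun v => (hl.2 v).1) v i, hval l' (fun v => (hl'.2 v).1) v i]
      simp only [h1]
    · rw [hsub l hl.1 v i hi, hsub l' hl'.1 v i hi]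
  · intro P hP
    simp only [mem_filter, mem_univ, true_and] at hP
    obtain ⟨l, hl⟩ := exists_vec_of_relation α.support (fun v i => v ∈ P i)
    have hl' : ∀ v (i : α.support), l v i = 1 ↔ v ∈ P i := by
      intro v i
      rw [hl]
      exact ⟨fun h => by_contra fun h' => by simp [h'] at h, fun h => by simp [h]⟩
    refine ⟨l, ?_, ?_⟩
    · rw [mem_filter, hsum]
      refine ⟨fun i => ?_, fun v => ⟨fun i hi => ?_, ?_⟩⟩
      · by_cases hi : i ∈ α.support
        · rw [← hP.1 ⟨i, hi⟩, ← sum_boole_mem (P ⟨i, hi⟩)]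
          refine sum_congr rfl fun v _ => ?_
          rw [hl]
          simp only [exists_prop_of_true hi]
        · rw [Finsupp.notMem_support_iff.1 hi]
          refine sum_eq_zero fun v _ => ?_
          rw [hl, if_neg fun h => hi h.1]
      · have := Finsupp.mem_support_iff.1 hi
        rw [hl] at this ⊢
        exact if_pos (by_contra fun h => this (if_neg h))
      · rw [← hP.2 v, ← card_map (Function.Embedding.subtype (· ∈ α.support))]
        congr 1
        ext i
        simp only [mem_map, mem_filter, mem_univ, true_and, Function.Embedding.subtype_apply,
          Subtype.exists, exists_and_right, exists_eq_right]
        rw [Finsupp.mem_support_iff, hl]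
        simp only [ne_eq, ite_eq_right_iff, one_ne_zero, imp_false, not_not]
    · funext i
      ext v
      simp only [M, mem_filter, mem_univ, true_and, hl']

end Duality

/-! ### Partitions as exponent vectors in finitely many variables -/

section Contents

open Finset

theorem ofFn_getD (L : List ℕ) {N : ℕ} (hN : L.length ≤ N) :
    List.ofFn (fun v : Fin N => L.getD v 0) = L ++ List.replicate (N - L.length) 0 := by
  apply List.ext_getElem
  · simp
    omega
  · intro i h₁ h₂
    simp only [List.getElem_ofFn, List.getD_eq_getElem?_getD, List.getElem_append,
      List.getElem_replicate]
    split_ifs with h <;> simp [h]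

/-- The exponent vector of a partition, with the parts in decreasing order. -/
noncomputable def partVec (N : ℕ) {n : ℕ} (μ : n.Partition) : Fin N →₀ ℕ :=
  Finsupp.equivFunOnFinite.symm (fun v => (μ.parts.sort (· ≥ ·)).getD v 0)

theorem partVec_apply (N : ℕ) {n : ℕ} (μ : n.Partition) (v : Fin N) :
    partVec N μ v = (μ.parts.sort (· ≥ ·)).getD v 0 := rfl

variable {N n : ℕ} {μ : n.Partition}

theorem map_partVec (h : μ.parts.card ≤ N) :
    (univ : Finset (Fin N)).val.map (partVec N μ)
      = μ.parts + Multiset.replicate (N - μ.parts.card) 0 := by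
  have hl : (μ.parts.sort (· ≥ ·)).length ≤ N := by simpa using h
  have := congrArg (fun l : List ℕ => (l : Multiset ℕ)) (ofFn_getD _ hl)
  simp only [← Multiset.coe_add, Multiset.sort_eq, Multiset.coe_replicate,
    Multiset.length_sort] at this
  rw [← this, Fin.univ_val_map]
  rfl

theorem map_support_partVec (h : μ.parts.card ≤ N) :
    (partVec N μ).support.val.map (partVec N μ) = μ.parts := by
  have h1 : (partVec N μ).support
      = (univ : Finset (Fin N)).filter (fun v => partVec N μ v ≠ 0) := by
    ext v
    simp
  rw [h1, filter_val]
  have h2 := Multiset.filter_map (fun x : ℕ => x ≠ 0) (partVec N μ) (univ : Finset (Fin N)).val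
  refine Eq.trans h2.symm ?_
  rw [map_partVec h, Multiset.filter_add,
    Multiset.filter_eq_self.2 fun x hx => (μ.parts_pos hx).ne']
  simp [Multiset.filter_eq_nil, Multiset.mem_replicate]

theorem card_support_partVec (h : μ.parts.card ≤ N) :
    (partVec N μ).support.card = μ.parts.card := by
  conv_rhs => rw [← map_support_partVec h]
  simp

theorem degree_partVec (h : μ.parts.card ≤ N) : (partVec N μ).degree = n := by
  refine Eq.trans ?_ μ.parts_sum
  rw [← map_support_partVec h]
  rfl

theorem card_parts_le (μ : n.Partition) : μ.parts.card ≤ n := by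
  have := Multiset.card_nsmul_le_sum (s := μ.parts) (a := 1) fun x hx => μ.parts_pos hx
  simpa [μ.parts_sum] using this

theorem elem_zero : elem 0 = 1 := by
  classical
  ext α
  rw [coeff_elem, MvPowerSeries.coeff_one]
  by_cases h : α = 0 <;> simp [h]

theorem elemPart_eq_prod (h : μ.parts.card ≤ N) : elemPart μ = ∏ v, elem (partVec N μ v) := by
  have h1 : ∏ v, elem (partVec N μ v) =
      (((univ : Finset (Fin N)).val.map (partVec N μ)).map elem).prod := by
    rw [Multiset.map_map]
    rfl
  rw [h1, map_partVec h]
  simp [elemPart, elem_zero]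

theorem coeff_elemPart (h : μ.parts.card ≤ N) (α : ℕ →₀ ℕ) :
    MvPowerSeries.coeff α (elemPart μ) = MvPolynomial.coeff (partVec N μ)
      ((α.support.val.map α).map (fun d => MvPolynomial.esymm (Fin N) ℚ d)).prod := by
  rw [elemPart_eq_prod h, coeff_prod_elem, Multiset.map_map]
  congr 1
  exact prod_coe_sort α.support (fun i => MvPolynomial.esymm (Fin N) ℚ (α i))

/-- Allows an identity between coefficients of power series to be tested on arbitrary multisets of
positive exponents. -/
theorem exists_exponents (s : Multiset ℕ) (hs : ∀ d ∈ s, 0 < d) :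
    ∃ α : ℕ →₀ ℕ, α.support.val.map α = s := by
  classical
  induction s using Quotient.inductionOn with | _ L => ?_
  have hL : ∀ d ∈ L, 0 < d := hs
  refine ⟨Finsupp.onFinset (range L.length) (fun i => L.getD i 0) ?_, ?_⟩
  · intro i hi
    by_contra h
    simp at h hi
    simp [h] at hi
  · have : (Finsupp.onFinset (range L.length) (fun i => L.getD i 0) (by
        intro i hi
        by_contra h
        simp at h hi
        simp [h] at hi)).support = range L.length := by
      ext i
      simp only [Finsupp.mem_support_iff, Finsupp.onFinset_apply, mem_range]
      by_cases h : i < L.length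
      · have := hL _ (List.getElem_mem h)
        simp [h]
        omega
      · simp [h]
    rw [this]
    refine congrArg (fun l : List ℕ => (l : Multiset ℕ))
      (?_ : (List.range L.length).map (fun i => L.getD i 0) = L)
    apply List.ext_getElem <;> simp
    intro i h
    simp [h]

end Contents

/-! ### The elementary expansion as an identity of functionals -/

section Expansion

open Finset MvPolynomial

/-- The generated algebra is spanned by the products of generators. With g_d = (e_d, e_{kd}) this
replaces the ring homomorphism e_d ↦ e_{kd}, which then need not be constructed. -/
theorem linearMap_eq_zero_of_mem_adjoin {A ι : Type*} [CommRing A] [Algebra ℚ A] (g : ι → A)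
    (L : A →ₗ[ℚ] ℚ) (hL : ∀ s : Multiset ι, L (s.map g).prod = 0) {x : A}
    (hx : x ∈ Algebra.adjoin ℚ (Set.range g)) : L x = 0 := by
  have hx' : x ∈ Submodule.span ℚ (Submonoid.closure (Set.range g) : Set A) := by
    rw [← Algebra.adjoin_eq_span]
    exact hx
  have hle : Submodule.span ℚ (Submonoid.closure (Set.range g) : Set A) ≤ LinearMap.ker L := by
    rw [Submodule.span_le]
    intro y hy
    obtain ⟨t, ht, rfl⟩ := Submonoid.exists_multiset_of_mem_closure hy
    have : ∃ s : Multiset ι, s.map g = t := by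
      clear hy hx hx'
      induction t using Multiset.induction_on with
      | empty => exact ⟨0, rfl⟩
      | cons a t ih =>
        obtain ⟨s, rfl⟩ := ih fun y hy => ht y (Multiset.mem_cons_of_mem hy)
        obtain ⟨i, rfl⟩ := ht a (Multiset.mem_cons_self _ _)
        exact ⟨i ::ₘ s, by simp⟩
    obtain ⟨s, rfl⟩ := this
    exact hL s
  exact hle hx'

theorem prod_map_filter_pos {M : Type*} [CommMonoid M] (g : ℕ → M) (h0 : g 0 = 1)
    (s : Multiset ℕ) : ((s.filter (0 < ·)).map g).prod = (s.map g).prod := by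
  induction s using Multiset.induction_on with
  | empty => simp
  | cons a s ih =>
    rcases Nat.eq_zero_or_pos a with rfl | ha
    · simp [h0, ih]
    · simp [ha, ih]

theorem isHomogeneous_esymm (N d : ℕ) : (esymm (Fin N) ℚ d).IsHomogeneous d := by
  rw [esymm]
  refine IsHomogeneous.sum _ _ _ fun S hS => ?_
  have := IsHomogeneous.prod S (fun i => (X i : MvPolynomial (Fin N) ℚ)) (fun _ => 1)
    fun i _ => isHomogeneous_X ℚ i
  simpa [(mem_powersetCard.1 hS).2] using this

theorem isHomogeneous_prod_esymm (N k : ℕ) (s : Multiset ℕ) :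
    ((s.map fun d => esymm (Fin N) ℚ (k * d)).prod).IsHomogeneous (k * s.sum) := by
  induction s using Multiset.induction_on with
  | empty => simpa using isHomogeneous_one (Fin N) ℚ
  | cons a s ih =>
    rw [Multiset.map_cons, Multiset.prod_cons, Multiset.sum_cons, mul_add]
    exact (isHomogeneous_esymm N _).mul ih

/-- The coefficient in `e_ν` of a monomial with the exponents `s`. -/
noncomputable def elemCoeff (N : ℕ) {n : ℕ} (ν : n.Partition) (s : Multiset ℕ) : ℚ :=
  coeff (partVec N ν) (s.map fun d => esymm (Fin N) ℚ d).prod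

variable {k n N : ℕ}

theorem coeff_elemPart_eq_elemCoeff {ν : n.Partition} (h : ν.parts.card ≤ N) (α : ℕ →₀ ℕ) :
    MvPowerSeries.coeff α (elemPart ν) = elemCoeff N ν (α.support.val.map α) :=
  coeff_elemPart h α

theorem elemCoeff_eq_zero {ν : n.Partition} (h : ν.parts.card ≤ N) {s : Multiset ℕ}
    (hs : s.sum ≠ n) : elemCoeff N ν s = 0 := by
  have := isHomogeneous_prod_esymm N 1 s
  simp only [one_mul] at this
  refine this.coeff_eq_zero ?_
  rw [degree_partVec h]
  exact hs.symm

theorem elemCoeff_filter_pos (ν : n.Partition) (s : Multiset ℕ) :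
    elemCoeff N ν (s.filter (0 < ·)) = elemCoeff N ν s := by
  rw [elemCoeff, elemCoeff, prod_map_filter_pos _ (by simp)]

theorem elemCoeff_map_mul_filter_pos (hk : 1 ≤ k) (ν : n.Partition) (s : Multiset ℕ) :
    elemCoeff N ν ((s.filter (0 < ·)).map (k * ·)) = elemCoeff N ν (s.map (k * ·)) := by
  rw [← elemCoeff_filter_pos (s := s.map _), Multiset.filter_map]
  congr 2
  refine Multiset.filter_congr fun x _ => ?_
  simp [Nat.pos_iff_ne_zero.1 hk, Nat.pos_iff_ne_zero]

theorem sum_filter_pos (s : Multiset ℕ) : (s.filter (0 < ·)).sum = s.sum := by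
  induction s using Multiset.induction_on with
  | empty => rfl
  | cons a s ih =>
    rcases Nat.eq_zero_or_pos a with rfl | ha
    · simpa using ih
    · simpa [ha] using ih

/-- The partition whose parts are the positive elements of a multiset. -/
def partitionOfSum (s : Multiset ℕ) (hs : s.sum = n) : n.Partition where
  parts := s.filter (0 < ·)
  parts_pos := fun hi => (Multiset.mem_filter.1 hi).2
  parts_sum := (sum_filter_pos s).trans hs

/-- Compare coefficients of x^α and dualize: α becomes a product of the e_{kα_i} on the left and of
the e_{α_i} on the right. Zeros in s are harmless because e_0 = 1. -/
theorem isElemExpansion_iff (hk : 1 ≤ k) {μ : (k * n).Partition} (hN : k * n ≤ N)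
    {c : n.Partition → ℚ} : IsElemExpansion (rowMap k (elemPart μ)) c ↔
      ∀ s : Multiset ℕ, elemCoeff N μ (s.map (k * ·)) = ∑ ν, c ν * elemCoeff N ν s := by
  have hμ : μ.parts.card ≤ N := (card_parts_le μ).trans hN
  have hν : ∀ ν : n.Partition, ν.parts.card ≤ N := fun ν =>
    (card_parts_le ν).trans ((Nat.le_mul_of_pos_left n hk).trans hN)
  have hcoeff : ∀ α : ℕ →₀ ℕ, MvPowerSeries.coeff α (rowMap k (elemPart μ))
      = elemCoeff N μ ((α.support.val.map α).map (k * ·)) := by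
    intro α
    rw [← exponents_smul hk, ← coeff_elemPart_eq_elemCoeff hμ]
    rfl
  have hcoeff' : ∀ α : ℕ →₀ ℕ, MvPowerSeries.coeff α (∑ ν, c ν • elemPart ν)
      = ∑ ν, c ν * elemCoeff N ν (α.support.val.map α) := by
    intro α
    rw [map_sum]
    refine sum_congr rfl fun ν _ => ?_
    rw [map_smul, smul_eq_mul, coeff_elemPart_eq_elemCoeff (hν ν)]
  constructor
  · intro h s
    obtain ⟨α, hα⟩ := exists_exponents (s.filter (0 < ·)) (by simp)
    have h1 := congrArg (MvPowerSeries.coeff α) h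
    rw [hcoeff, hcoeff', hα] at h1
    simp only [elemCoeff_filter_pos] at h1
    rw [← h1, elemCoeff_map_mul_filter_pos hk]
  · intro h
    ext α
    rw [hcoeff, hcoeff', h]

open Classical in
theorem coeff_partVec_msymm (hN : n ≤ N) (ν lam : n.Partition) :
    coeff (partVec N ν) (msymm (Fin N) ℚ lam) = if ν = lam then 1 else 0 := by
  have hν : ν.parts.card ≤ N := (card_parts_le ν).trans hN
  have hm : ∀ s : Multiset (Fin N), (s.map (X : Fin N → MvPolynomial (Fin N) ℚ)).prod
      = monomial (Multiset.toFinsupp s) 1 := by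
    intro s
    induction s using Multiset.induction_on with
    | empty => simp
    | cons a s ih =>
      rw [Multiset.map_cons, Multiset.prod_cons, ih, ← Multiset.singleton_add, map_add,
        Multiset.toFinsupp_singleton, X, monomial_mul, one_mul]
  have hof : ∀ a : Sym (Fin N) n, Multiset.toFinsupp a.1 = partVec N ν →
      Nat.Partition.ofSym a = ν := by
    intro a ha
    ext1
    rw [← map_support_partVec hν, ← ha]
    simp only [Nat.Partition.ofSym, Multiset.toFinsupp_support, Multiset.toFinset_val]
    refine Multiset.map_congr ?_ fun _ _ => ?_
    · congr!
    · rw [Multiset.toFinsupp_apply]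
  rw [msymm, coeff_sum]
  simp only [hm, coeff_monomial]
  split_ifs with h
  · subst h
    have hc : (Finsupp.toMultiset (partVec N ν)).card = n := by
      rw [Finsupp.card_toMultiset]
      exact degree_partVec hν
    let a : Sym (Fin N) n := ⟨Finsupp.toMultiset (partVec N ν), hc⟩
    have ha : Multiset.toFinsupp a.1 = partVec N ν := Finsupp.toMultiset_toFinsupp _
    rw [sum_eq_single (⟨a, hof a ha⟩ : {a : Sym (Fin N) n // Nat.Partition.ofSym a = ν})]
    · exact if_pos ha
    · intro b _ hb
      refine if_neg fun h => hb ?_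
      ext1
      ext1
      exact Multiset.toFinsupp.injective (h.trans ha.symm)
    · simp
  · refine sum_eq_zero fun a _ => if_neg fun ha => h ?_
    rw [← hof a.1 ha, a.2]

theorem msymm_mem_adjoin (N : ℕ) (lam : n.Partition) :
    msymm (Fin N) ℚ lam ∈ Algebra.adjoin ℚ (Set.range (fun d => esymm (Fin N) ℚ d)) := by
  obtain ⟨q, hq⟩ := esymmAlgHom_fin_surjective (R := ℚ) (n := N) (m := N) le_rfl
    ⟨msymm (Fin N) ℚ lam, msymm_isSymmetric _ _ _⟩
  have h : aeval (fun i : Fin N => esymm (Fin N) ℚ (i + 1)) q = msymm (Fin N) ℚ lam := by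
    rw [← esymmAlgHom_apply, hq]
  rw [← h]
  have : aeval (fun i : Fin N => esymm (Fin N) ℚ (i + 1)) q
      ∈ (aeval (R := ℚ) (fun i : Fin N => esymm (Fin N) ℚ (i + 1))).range := ⟨q, rfl⟩
  rw [← Algebra.adjoin_range_eq_range_aeval] at this
  refine Algebra.adjoin_mono ?_ this
  rintro _ ⟨i, rfl⟩
  exact ⟨i + 1, rfl⟩

/-- The functional ∑ c_ν [x^ν] kills all products of the e_d (by degree, when the degree is not n),
hence the algebra they generate. That algebra contains the monomial symmetric polynomials, on which
the functional takes the values c_ν. -/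
theorem eq_zero_of_sum_mul_elemCoeff_eq_zero (hN : n ≤ N) {c : n.Partition → ℚ}
    (h : ∀ lam : n.Partition, ∑ ν, c ν * elemCoeff N ν lam.parts = 0) : c = 0 := by
  classical
  let L : MvPolynomial (Fin N) ℚ →ₗ[ℚ] ℚ := ∑ ν, c ν • lcoeff ℚ (partVec N ν)
  have hLa : ∀ p, L p = ∑ ν, c ν * coeff (partVec N ν) p := by
    intro p
    simp [L]
  have hν : ∀ ν : n.Partition, ν.parts.card ≤ N := fun ν => (card_parts_le ν).trans hN
  have hL : ∀ s : Multiset ℕ, L (s.map fun d => esymm (Fin N) ℚ d).prod = 0 := by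
    intro s
    rw [hLa]
    change ∑ ν, c ν * elemCoeff N ν s = 0
    by_cases hs : s.sum = n
    · simp only [← elemCoeff_filter_pos (s := s)]
      exact h (partitionOfSum s hs)
    · exact sum_eq_zero fun ν _ => by rw [elemCoeff_eq_zero (hν ν) hs, mul_zero]
  funext lam
  have := linearMap_eq_zero_of_mem_adjoin _ L hL (msymm_mem_adjoin N lam)
  rw [hLa] at this
  simpa [coeff_partVec_msymm hN] using this

theorem existsUnique_isElemExpansion (hk : 1 ≤ k) (μ : (k * n).Partition) :
    ∃! c : n.Partition → ℚ, IsElemExpansion (rowMap k (elemPart μ)) c := by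
  have hn : n ≤ k * n := Nat.le_mul_of_pos_left n hk
  let Φ : (n.Partition → ℚ) →ₗ[ℚ] (n.Partition → ℚ) :=
    { toFun := fun c lam => ∑ ν, c ν * elemCoeff (k * n) ν lam.parts
      map_add' := fun c c' => by
        funext lam
        simp [add_mul, sum_add_distrib]
      map_smul' := fun a c => by
        funext lam
        simp [mul_sum, mul_assoc] }
  have hinj : Function.Injective Φ := by
    rw [injective_iff_map_eq_zero]
    exact fun c hc => eq_zero_of_sum_mul_elemCoeff_eq_zero hn fun lam => congrFun hc lam
  -- The system is square, with equations and unknowns both indexed by the partitions of n, so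
  -- uniqueness yields existence.
  have hsurj := LinearMap.injective_iff_surjective.1 hinj
  obtain ⟨c, hc⟩ := hsurj fun lam => elemCoeff (k * n) μ (lam.parts.map (k * ·))
  refine ⟨c, ?_, fun c' hc' => hinj ?_⟩
  · change IsElemExpansion _ c
    rw [isElemExpansion_iff hk le_rfl]
    intro s
    by_cases hs : s.sum = n
    · rw [← elemCoeff_map_mul_filter_pos hk]
      simp only [← elemCoeff_filter_pos (s := s)]
      exact (congrFun hc (partitionOfSum s hs)).symm
    · rw [elemCoeff_eq_zero (card_parts_le μ), sum_eq_zero]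
      · intro ν _
        rw [elemCoeff_eq_zero ((card_parts_le ν).trans hn) hs, mul_zero]
      · rw [Multiset.sum_map_mul_left, Multiset.map_id']
        exact fun h => hs (Nat.eq_of_mul_eq_mul_left hk h)
  · rw [hc]
    funext lam
    exact ((isElemExpansion_iff hk le_rfl).1 hc' lam.parts).symm

/-- The two components satisfy the same recursion in e_j and in e_{kj}; solving it for the term j =
0 expresses the pair through earlier pairs and the generators. -/
theorem mem_adjoin_noDescentSum (hk : 1 ≤ k) (N m : ℕ) :
    (completeSum N m, noDescentSum k N m) ∈ Algebra.adjoin ℚ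
      (Set.range (fun d => (esymm (Fin N) ℚ d, esymm (Fin N) ℚ (k * d)))) := by
  induction m using Nat.strong_induction_on with
  | _ m ih =>
    rcases Nat.eq_zero_or_pos m with rfl | hm
    · rw [completeSum_zero, noDescentSum_zero]
      exact one_mem _
    · have h1 := sum_neg_one_pow_mul_esymm_mul_completeSum N hm
      have h2 := sum_neg_one_pow_mul_esymm_mul_noDescentSum hk N hm
      rw [sum_range_succ'] at h1 h2
      have h : (completeSum N m, noDescentSum k N m) = -∑ j ∈ range m, (-1) ^ (j + 1) *
          ((esymm (Fin N) ℚ (j + 1), esymm (Fin N) ℚ (k * (j + 1))) *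
            (completeSum N (m - (j + 1)), noDescentSum k N (m - (j + 1)))) := by
        ext1
        · simp only [Prod.fst_neg, Prod.fst_sum, Prod.fst_mul, Prod.pow_fst, Prod.fst_one]
          rw [eq_neg_iff_add_eq_zero, add_comm, ← h1]
          simp
        · simp only [Prod.snd_neg, Prod.snd_sum, Prod.snd_mul, Prod.pow_snd, Prod.snd_one]
          rw [eq_neg_iff_add_eq_zero, add_comm, ← h2]
          simp
      rw [h]
      refine neg_mem (sum_mem fun j hj => mul_mem (pow_mem (neg_mem (one_mem _)) _)
        (mul_mem (Algebra.subset_adjoin ⟨j + 1, rfl⟩) (ih _ (by omega))))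

-- The functional L, the difference of the two sides, vanishes on products of the pairs (e_d,
-- e_{kd}), hence on (e_j h_{n-j}, e_{kj} D_{n-j}), where D denotes `noDescentSum`. Both components
-- have coefficients given by binomials.
open Classical in
theorem sum_mul_choose_eq (hk : 1 ≤ k) {μ : (k * n).Partition} {c : n.Partition → ℚ}
    (hc : IsElemExpansion (rowMap k (elemPart μ)) c) {j : ℕ} (hj : j ≤ n) :
    ∑ ν, c ν * (ν.parts.card.choose j : ℚ)
      = ∑ w ∈ noDescentWords (SortedBlockLT k (k * n)) n with wordContent w = partVec (k * n) μ,
        ((recordSet (SortedBlockLT k (k * n)) w).card.choose j : ℚ) := by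
  have hn : n ≤ k * n := Nat.le_mul_of_pos_left n hk
  have hν : ∀ ν : n.Partition, ν.parts.card ≤ k * n := fun ν => (card_parts_le ν).trans hn
  let L : MvPolynomial (Fin (k * n)) ℚ × MvPolynomial (Fin (k * n)) ℚ →ₗ[ℚ] ℚ :=
    (∑ ν, c ν • lcoeff ℚ (partVec (k * n) ν)).comp (LinearMap.fst ℚ _ _)
      - (lcoeff ℚ (partVec (k * n) μ)).comp (LinearMap.snd ℚ _ _)
  have hLa : ∀ p, L p = ∑ ν, c ν * coeff (partVec (k * n) ν) p.1
      - coeff (partVec (k * n) μ) p.2 := by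
    intro p
    simp [L]
  have hL : ∀ s : Multiset ℕ, L (s.map fun d =>
      (esymm (Fin (k * n)) ℚ d, esymm (Fin (k * n)) ℚ (k * d))).prod = 0 := by
    intro s
    rw [hLa, ← RingHom.coe_fst, ← RingHom.coe_snd, map_multiset_prod, map_multiset_prod,
      Multiset.map_map, Multiset.map_map, sub_eq_zero]
    have := (isElemExpansion_iff hk le_rfl).1 hc s
    simp only [elemCoeff, Multiset.map_map] at this
    exact this.symm
  have hmem := mul_mem (Algebra.subset_adjoin (R := ℚ) (Set.mem_range_self
    (f := fun d => (esymm (Fin (k * n)) ℚ d, esymm (Fin (k * n)) ℚ (k * d))) j))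
    (mem_adjoin_noDescentSum hk (k * n) (n - j))
  have h := linearMap_eq_zero_of_mem_adjoin _ L hL hmem
  rw [hLa, sub_eq_zero, Prod.fst_mul, Prod.snd_mul, coeff_esymm_mul_noDescentSum hk,
    Nat.add_sub_cancel' hj] at h
  rw [← h]
  refine sum_congr rfl fun ν _ => ?_
  rw [coeff_esymm_mul_completeSum, Nat.add_sub_cancel' hj, if_pos (degree_partVec (hν ν)),
    card_support_partVec (hν ν)]

/-- The matrix of binomial coefficients is unitriangular; solve from s = n downwards. -/
theorem eq_of_sum_mul_choose_eq {n : ℕ} {d : ℕ → ℚ}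
    (h : ∀ j ≤ n, ∑ s ∈ range (n + 1), d s * (s.choose j : ℚ) = 0) {r : ℕ} (hr : r ≤ n) :
    d r = 0 := by
  induction hm : n - r using Nat.strong_induction_on generalizing r with
  | _ m ih =>
    have h1 := h r hr
    rw [sum_eq_single r] at h1
    · simpa using h1
    · intro s hs hsr
      rcases lt_or_gt_of_ne hsr with hlt | hlt
      · rw [Nat.choose_eq_zero_of_lt hlt]
        simp
      · have := mem_range.1 hs
        rw [ih (n - s) (by omega) (by omega) rfl, zero_mul]
    · intro hr'
      exact absurd (mem_range.2 (by omega)) hr'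

open Classical in
theorem sum_coeff_eq_card_words (hk : 1 ≤ k) {μ : (k * n).Partition} {c : n.Partition → ℚ}
    (hc : IsElemExpansion (rowMap k (elemPart μ)) c) {r : ℕ} (hr : r ≤ n) :
    ∑ ν : n.Partition with ν.parts.card = r, c ν
      = (((noDescentWords (SortedBlockLT k (k * n)) n).filter fun w =>
          wordContent w = partVec (k * n) μ ∧
            (recordSet (SortedBlockLT k (k * n)) w).card = r).card : ℚ) := by
  let W := (noDescentWords (SortedBlockLT k (k * n)) n).filter
    fun w => wordContent w = partVec (k * n) μ
  let d : ℕ → ℚ := fun s => ∑ ν : n.Partition with ν.parts.card = s, c ν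
    - ∑ w ∈ W with (recordSet (SortedBlockLT k (k * n)) w).card = s, 1
  have hd : d r = 0 := by
    refine eq_of_sum_mul_choose_eq (n := n) (fun j hj => ?_) hr
    have h1 : ∑ ν : n.Partition, c ν * (ν.parts.card.choose j : ℚ)
        = ∑ s ∈ range (n + 1), (∑ ν : n.Partition with ν.parts.card = s, c ν) * (s.choose j : ℚ) := by
      rw [← sum_fiberwise_of_maps_to (t := range (n + 1)) (g := fun ν : n.Partition => ν.parts.card)]
      · refine sum_congr rfl fun s _ => ?_
        rw [sum_mul]
        exact sum_congr rfl fun ν hν => by rw [(mem_filter.1 hν).2]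
      · exact fun ν _ => mem_range.2 (Nat.lt_succ_of_le (card_parts_le ν))
    have h2 : ∑ w ∈ W, ((recordSet (SortedBlockLT k (k * n)) w).card.choose j : ℚ)
        = ∑ s ∈ range (n + 1),
          (∑ w ∈ W with (recordSet (SortedBlockLT k (k * n)) w).card = s, 1) * (s.choose j : ℚ) := by
      rw [← sum_fiberwise_of_maps_to (t := range (n + 1))
        (g := fun w => (recordSet (SortedBlockLT k (k * n)) w).card)]
      · refine sum_congr rfl fun s _ => ?_
        rw [sum_mul]
        exact sum_congr rfl fun w hw => by rw [(mem_filter.1 hw).2, one_mul]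
      · intro w hw
        simp only [W, noDescentWords, mem_filter, mem_wordsOfLength] at hw
        exact mem_range.2 (Nat.lt_succ_of_le ((card_recordSet_le _ w).trans_eq hw.1.1))
    simp only [d, sub_mul, sum_sub_distrib]
    rw [← h1, ← h2, sum_mul_choose_eq hk hc hj, sub_self]
  have := sub_eq_zero.1 hd
  rw [this, sum_const, nsmul_eq_mul, mul_one, filter_filter]

end Expansion

/-! ### Tableaux of shape `SH(i)` as pairs of lists of blocks -/

section Tableaux

open Finset

variable {k n i : ℕ}

theorem mem_SH (hi : i < n) {x y : ℕ} : (x, y) ∈ SH k n i ↔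
    y < n - i ∧ shTop k n i y ≤ x ∧ x < shTop k n i y + shLen k i y := by
  simp only [SH, mem_filter, mem_product, mem_range]
  refine ⟨fun h => ⟨h.1.2, h.2⟩, fun h => ⟨⟨lt_of_lt_of_le h.2.2 ?_, h.1⟩, h.2⟩⟩
  -- The bounding box of kn rows imposes nothing: a column starts at row dk at the latest and has at
  -- most k(i + 1) cells, and dk + k(i + 1) = kn.
  obtain ⟨d, rfl⟩ : ∃ d, n = d + i + 1 := ⟨n - 1 - i, by omega⟩
  have h1 : shTop k (d + i + 1) i y ≤ d * k :=
    Nat.mul_le_mul (by omega) (by omega)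
  have h2 : shLen k i y ≤ k * (i + 1) := by
    rw [shLen]
    split_ifs
    · exact le_rfl
    · exact Nat.le_mul_of_pos_right k (by omega)
  nlinarith

theorem shTop_succ {y : ℕ} (hy : y + 1 < n - i) :
    shTop k n i (y + 1) + (k - 1) = shTop k n i y := by
  obtain ⟨e, he⟩ : ∃ e, n - 1 - i - y = e + 1 := ⟨n - 1 - i - (y + 1), by omega⟩
  rw [shTop, shTop, he, show n - 1 - i - (y + 1) = e by omega, add_mul, one_mul]

theorem mem_SH_zero (hi : i < n) {q : ℕ} (hq : q < k * (i + 1)) :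
    (shTop k n i 0 + q, 0) ∈ SH k n i := by
  rw [mem_SH hi]
  refine ⟨by omega, by omega, ?_⟩
  simpa [shLen] using hq

theorem mem_SH_column (hi : i < n) {y p : ℕ} (hy : y < n - i) (hp : p < k) :
    (shTop k n i y + p, y) ∈ SH k n i := by
  rw [mem_SH hi]
  refine ⟨hy, by omega, ?_⟩
  have : k ≤ shLen k i y := by
    rw [shLen]
    split_ifs
    · exact Nat.le_mul_of_pos_right k (by omega)
    · exact le_rfl
  omega

theorem mul_add_lt_mul (b : Fin (i + 1)) (p : Fin k) : k * b + p < k * (i + 1) := by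
  have h1 : k * (b + 1 : ℕ) ≤ k * (i + 1) := Nat.mul_le_mul_left k b.2
  have := p.2
  rw [mul_add, mul_one] at h1
  omega

/-- A block of positive integers which increases strictly. -/
def IsGoodBlock (b : Fin k → ℕ) : Prop := StrictMono b ∧ ∀ p, 1 ≤ b p

/-- The lists of blocks of the first column and of the upper-right region of a tableau of shape
`SH(i)`. -/
structure IsTableauPair (k n i : ℕ) (X C : List (Fin k → ℕ)) : Prop where
  length_first : X.length = i + 1
  length_upper : C.length = n - 1 - i
  good_first : ∀ b ∈ X, IsGoodBlock b
  good_upper : ∀ b ∈ C, IsGoodBlock b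
  chain : X.Pairwise BlockLT
  noDescent : NoDescent BlockLT (X.take 1 ++ C)

/-- The top block of each column. -/
def columnTop (T : SkewSSYT (SH k n i)) (y : ℕ) : Fin k → ℕ :=
  fun p => T.entry (shTop k n i y + p) y

theorem take_firstBlocks_append (T : SkewSSYT (SH k n i)) :
    (firstBlocks T).take 1 ++ upperBlocks T
      = List.ofFn (fun y : Fin (n - 1 - i + 1) => columnTop T y) := by
  rw [firstBlocks, List.ofFn_succ, List.ofFn_succ]
  simp only [List.take_succ_cons, List.take_zero, List.singleton_append]
  congr 1

theorem length_firstBlocks (T : SkewSSYT (SH k n i)) : (firstBlocks T).length = i + 1 := by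
  simp [firstBlocks]

theorem length_upperBlocks (T : SkewSSYT (SH k n i)) : (upperBlocks T).length = n - 1 - i := by
  simp [upperBlocks]

theorem getElem_firstBlocks (T : SkewSSYT (SH k n i)) {b : ℕ} (hb : b < (firstBlocks T).length) :
    (firstBlocks T)[b] = firstBlock T b := by
  simp only [firstBlocks, List.getElem_ofFn]

theorem getElem_upperBlocks (T : SkewSSYT (SH k n i)) {z : ℕ} (hz : z < (upperBlocks T).length) :
    (upperBlocks T)[z] = columnTop T (z + 1) := by
  simp only [upperBlocks, List.getElem_ofFn]
  rfl

theorem isTableauPair (hk : 1 ≤ k) (hi : i < n) (T : SkewSSYT (SH k n i)) :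
    IsTableauPair k n i (firstBlocks T) (upperBlocks T) where
  length_first := length_firstBlocks T
  length_upper := length_upperBlocks T
  good_first := by
    intro c hc
    obtain ⟨b, rfl⟩ := (List.mem_ofFn' _ _).1 hc
    refine ⟨fun p q hpq => ?_, fun p => ?_⟩
    · have h1 := mem_SH_zero hi (mul_add_lt_mul b p)
      have h2 := mem_SH_zero hi (mul_add_lt_mul b q)
      rw [← add_assoc] at h1 h2
      exact T.col_strict h1 h2 (by have := Fin.lt_def.1 hpq; omega)
    · have h1 := mem_SH_zero hi (mul_add_lt_mul b p)
      rw [← add_assoc] at h1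
      exact T.pos h1
  good_upper := by
    intro c hc
    obtain ⟨j, rfl⟩ := (List.mem_ofFn' _ _).1 hc
    have hj : (j : ℕ) + 1 < n - i := by
      have := j.2
      omega
    refine ⟨fun p q hpq => ?_, fun p => ?_⟩
    · exact T.col_strict (mem_SH_column hi hj p.2) (mem_SH_column hi hj q.2)
        (by have := Fin.lt_def.1 hpq; omega)
    · exact T.pos (mem_SH_column hi hj p.2)
  chain := by
    rw [firstBlocks, List.pairwise_ofFn]
    intro a b hab p q
    have h1 := mem_SH_zero hi (mul_add_lt_mul a p)
    have h2 := mem_SH_zero hi (mul_add_lt_mul b q)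
    have h3 : k * (a + 1 : ℕ) ≤ k * b := Nat.mul_le_mul_left k hab
    have := p.2
    rw [← add_assoc] at h1 h2
    rw [mul_add, mul_one] at h3
    exact T.col_strict h1 h2 (by omega)
  noDescent := by
    rw [take_firstBlocks_append, NoDescent, List.isChain_iff_getElem]
    intro y hy h
    rw [List.length_ofFn] at hy
    simp only [List.getElem_ofFn] at h
    have hy' : y + 1 < n - i := by omega
    -- The bottom cell of column y + 1 and the top cell of column y are neighbours in a row; a
    -- descent would put the smaller entry on the right.
    have h1 := h ⟨k - 1, by omega⟩ ⟨0, hk⟩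
    simp only [columnTop, add_zero, shTop_succ hy'] at h1
    refine absurd h1 (not_lt.2 (T.row_weak ?_ ?_ (by omega)))
    · simpa using mem_SH_column (k := k) hi (y := y) (p := 0) (by omega) (by omega)
    · rw [← shTop_succ hy']
      exact mem_SH_column hi hy' (by omega)

open Classical in
/-- The filling of `SH(i)` with given blocks of the first column and of the upper-right region. -/
noncomputable def fillEntry (hk : 1 ≤ k) (n i : ℕ) (X C : List (Fin k → ℕ)) (x y : ℕ) : ℕ :=
  if (x, y) ∈ SH k n i then
    (if y = 0 then X.getD ((x - shTop k n i 0) / k) 0 ⟨(x - shTop k n i 0) % k, Nat.mod_lt _ hk⟩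
      else C.getD (y - 1) 0 ⟨(x - shTop k n i y) % k, Nat.mod_lt _ hk⟩)
  else 0

theorem fillEntry_zero (hk : 1 ≤ k) (hi : i < n) (X C : List (Fin k → ℕ)) {b : ℕ} (hb : b < i + 1)
    (p : Fin k) : fillEntry hk n i X C (shTop k n i 0 + k * b + p) 0 = X.getD b 0 p := by
  have h := mem_SH_zero (k := k) hi (mul_add_lt_mul ⟨b, hb⟩ p)
  rw [← add_assoc] at h
  rw [fillEntry, if_pos h, if_pos rfl]
  have h1 : shTop k n i 0 + k * b + p - shTop k n i 0 = k * b + p := by omega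
  have h2 : (k * b + p) / k = b := by
    rw [Nat.mul_add_div hk, Nat.div_eq_of_lt p.2, add_zero]
  have h3 : (k * b + p) % k = p := by
    rw [Nat.mul_add_mod, Nat.mod_eq_of_lt p.2]
  simp only [h1, h2, h3]

theorem fillEntry_succ (hk : 1 ≤ k) (hi : i < n) (X C : List (Fin k → ℕ)) {y : ℕ}
    (hy : y + 1 < n - i) (p : Fin k) :
    fillEntry hk n i X C (shTop k n i (y + 1) + p) (y + 1) = C.getD y 0 p := by
  rw [fillEntry, if_pos (mem_SH_column hi hy p.2), if_neg (by omega)]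
  have h1 : (shTop k n i (y + 1) + p - shTop k n i (y + 1)) % k = p := by
    rw [Nat.add_sub_cancel_left, Nat.mod_eq_of_lt p.2]
  simp only [h1, Nat.add_sub_cancel]

/-- The cells of `SH(i)`: those of the first column and those of the other columns. -/
theorem cell_cases (hk : 1 ≤ k) (hi : i < n) {x y : ℕ} (h : (x, y) ∈ SH k n i) :
    (∃ b < i + 1, ∃ p : Fin k, x = shTop k n i 0 + k * b + p ∧ y = 0) ∨
      ∃ z, z + 1 < n - i ∧ ∃ p : Fin k, x = shTop k n i (z + 1) + p ∧ y = z + 1 := by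
  rw [mem_SH hi] at h
  obtain ⟨h1, h2, h3⟩ := h
  cases y with
  | zero =>
    left
    simp only [shLen, if_true] at h3
    refine ⟨(x - shTop k n i 0) / k, Nat.div_lt_of_lt_mul (by omega),
      ⟨(x - shTop k n i 0) % k, Nat.mod_lt _ hk⟩, ?_, rfl⟩
    have := Nat.div_add_mod (x - shTop k n i 0) k
    simp only
    omega
  | succ z =>
    right
    simp only [shLen, Nat.succ_ne_zero, if_false] at h3
    exact ⟨z, h1, ⟨x - shTop k n i (z + 1), by omega⟩, by simp only; omega, rfl⟩

theorem entry_eq_fillEntry (hk : 1 ≤ k) (hi : i < n) (T : SkewSSYT (SH k n i)) :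
    T.entry = fillEntry hk n i (firstBlocks T) (upperBlocks T) := by
  funext x y
  by_cases h : (x, y) ∈ SH k n i
  · rcases cell_cases hk hi h with ⟨b, hb, p, rfl, rfl⟩ | ⟨z, hz, p, rfl, rfl⟩
    · rw [fillEntry_zero hk hi _ _ hb, firstBlocks, List.getD_eq_getElem _ _ (by simpa using hb),
        List.getElem_ofFn]
      rfl
    · rw [fillEntry_succ hk hi _ _ hz, upperBlocks,
        List.getD_eq_getElem _ _ (by rw [List.length_ofFn]; omega), List.getElem_ofFn]
  · rw [fillEntry, if_neg h, T.zeros h]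

theorem tableau_ext (hk : 1 ≤ k) (hi : i < n) {T T' : SkewSSYT (SH k n i)}
    (h : firstBlocks T = firstBlocks T') (h' : upperBlocks T = upperBlocks T') : T = T' := by
  ext x y
  rw [entry_eq_fillEntry hk hi, entry_eq_fillEntry hk hi, h, h']

theorem IsGoodBlock.le_of_not_blockLT (hk : 1 ≤ k) {b c : Fin k → ℕ} (hb : IsGoodBlock b)
    (hc : IsGoodBlock c) (h : ¬ BlockLT c b) : b ⟨0, hk⟩ ≤ c ⟨k - 1, by omega⟩ := by
  simp only [BlockLT, not_forall, not_lt] at h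
  obtain ⟨p, q, h⟩ := h
  exact ((hb.1.monotone (Fin.le_def.2 (by simp))).trans h).trans
    (hc.1.monotone (Fin.le_def.2 (by have := p.2; simp only; omega)))

/-- For increasing blocks, the absence of a descent says that the top entry of a column is at most
the bottom entry of the next, which is exactly the row condition of the ribbon. -/
theorem exists_tableau (hk : 1 ≤ k) (hi : i < n) {X C : List (Fin k → ℕ)}
    (h : IsTableauPair k n i X C) :
    ∃ T : SkewSSYT (SH k n i), firstBlocks T = X ∧ upperBlocks T = C := by
  have hX : ∀ {b}, b < i + 1 → X.getD b 0 ∈ X := fun {b} hb => by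
    rw [List.getD_eq_getElem _ _ (by rw [h.length_first]; exact hb)]
    exact List.getElem_mem _
  have hC : ∀ {z}, z + 1 < n - i → C.getD z 0 ∈ C := fun {z} hz => by
    rw [List.getD_eq_getElem _ _ (by rw [h.length_upper]; omega)]
    exact List.getElem_mem _
  let D : ℕ → Fin k → ℕ := fun y => if y = 0 then X.getD 0 0 else C.getD (y - 1) 0
  have hD : ∀ y < n - i, IsGoodBlock (D y) := by
    intro y hy
    cases y with
    | zero => exact h.good_first _ (hX (by omega))
    | succ z => exact h.good_upper _ (hC hy)
  have hDD : ∀ y, y + 1 < n - i → D y ⟨0, hk⟩ ≤ D (y + 1) ⟨k - 1, by omega⟩ := by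
    intro y hy
    refine (hD y (by omega)).le_of_not_blockLT hk (hD _ hy) ?_
    have hlist : X.take 1 ++ C = D 0 :: C := by
      obtain ⟨x, X', hX'⟩ := List.exists_cons_of_length_eq_add_one h.length_first
      simp [D, hX']
    have hget : ∀ z (hz : z < (D 0 :: C).length), (D 0 :: C)[z] = D z := by
      intro z hz
      cases z with
      | zero => rfl
      | succ z =>
        rw [List.getElem_cons_succ]
        exact (List.getD_eq_getElem _ _ _).symm
    have hch := h.noDescent
    rw [hlist, NoDescent, List.isChain_iff_getElem] at hch
    have := hch y (by rw [List.length_cons, h.length_upper]; omega)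
    rwa [hget, hget] at this
  have htop : ∀ y < n - i, fillEntry hk n i X C (shTop k n i y) y = D y ⟨0, hk⟩ := by
    intro y hy
    cases y with
    | zero => exact fillEntry_zero hk hi X C (b := 0) (by omega) ⟨0, hk⟩
    | succ z => exact fillEntry_succ hk hi X C hy ⟨0, hk⟩
  have hbot : ∀ y, y + 1 < n - i →
      fillEntry hk n i X C (shTop k n i y) (y + 1) = D (y + 1) ⟨k - 1, by omega⟩ := by
    intro y hy
    rw [← shTop_succ hy]
    exact fillEntry_succ hk hi X C hy ⟨k - 1, by omega⟩
  let T : SkewSSYT (SH k n i) :=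
    { entry := fillEntry hk n i X C
      pos := by
        intro x y hxy
        rcases cell_cases hk hi hxy with ⟨b, hb, p, rfl, rfl⟩ | ⟨z, hz, p, rfl, rfl⟩
        · rw [fillEntry_zero hk hi _ _ hb]
          exact (h.good_first _ (hX hb)).2 p
        · rw [fillEntry_succ hk hi _ _ hz]
          exact (h.good_upper _ (hC hz)).2 p
      row_weak := by
        intro x y₁ y₂ h₁ h₂ hlt
        rw [mem_SH hi] at h₁ h₂
        obtain ⟨hy₁, htop₁, -⟩ := h₁
        obtain ⟨hy₂, htop₂, hx₂⟩ := h₂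
        rw [shLen, if_neg (by omega)] at hx₂
        -- For k = 1 the top cells of all columns form one long row, and the inequalities between
        -- neighbours have to be chained. For k ≥ 2 a row meets at most two columns, which are
        -- adjacent.
        rcases hk.eq_or_lt with rfl | hk'
        · have h0 : ∀ y, shTop 1 n i y = 0 := fun y => by simp [shTop]
          obtain rfl : x = 0 := by
            rw [h0] at hx₂
            omega
          have h1 := htop y₁ hy₁
          have h2 := htop y₂ hy₂
          rw [h0] at h1 h2
          rw [h1, h2]
          clear h1 h2 htop₁ htop₂ hx₂
          induction y₂, hlt using Nat.le_induction with
          | base => exact hDD y₁ hy₂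
          | succ y hy ih => exact (ih (by omega)).trans (hDD y hy₂)
        · have h1 := shTop_succ (k := k) (n := n) (i := i) (y := y₁) (by omega)
          obtain rfl : y₂ = y₁ + 1 := by
            by_contra hne
            have h2 := shTop_succ (k := k) (n := n) (i := i) (y := y₁ + 1) (by omega)
            have h3 : shTop k n i y₂ ≤ shTop k n i (y₁ + 1 + 1) :=
              Nat.mul_le_mul_right _ (by omega)
            omega
          obtain rfl : x = shTop k n i y₁ := by omega
          rw [htop y₁ hy₁, hbot y₁ hy₂]
          exact hDD y₁ hy₂
      col_strict := by
        intro x₁ x₂ y h₁ h₂ hlt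
        rcases cell_cases hk hi h₁ with ⟨b, hb, p, rfl, rfl⟩ | ⟨z, hz, p, rfl, rfl⟩
        · rcases cell_cases hk hi h₂ with ⟨c, hc, q, rfl, _⟩ | ⟨z, hz, q, _, h0⟩
          · rw [fillEntry_zero hk hi _ _ hb, fillEntry_zero hk hi _ _ hc]
            rcases lt_trichotomy b c with hbc | rfl | hbc
            · have := List.pairwise_iff_getElem.1 h.chain b c (by rw [h.length_first]; exact hb)
                (by rw [h.length_first]; exact hc) hbc
              rw [← List.getD_eq_getElem (d := 0), ← List.getD_eq_getElem (d := 0)] at this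
              exact this p q
            · exact (h.good_first _ (hX hb)).1 (Fin.lt_def.2 (by omega))
            · have h3 : k * (c + 1 : ℕ) ≤ k * b := Nat.mul_le_mul_left k hbc
              rw [mul_add, mul_one] at h3
              have := q.2
              omega
          · omega
        · rcases cell_cases hk hi h₂ with ⟨c, hc, q, rfl, h0⟩ | ⟨z', hz', q, hx, h0⟩
          · omega
          · obtain rfl : z = z' := by omega
            rw [hx, fillEntry_succ hk hi _ _ hz, fillEntry_succ hk hi _ _ hz]
            exact (h.good_upper _ (hC hz)).1 (Fin.lt_def.2 (by omega))
      zeros := fun h => if_neg h }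
  refine ⟨T, ?_, ?_⟩
  · refine List.ext_getElem (by rw [length_firstBlocks, h.length_first]) fun b h₁ h₂ => ?_
    rw [length_firstBlocks] at h₁
    have := fillEntry_zero hk hi X C h₁
    rw [List.getD_eq_getElem _ _ h₂] at this
    rw [getElem_firstBlocks]
    exact funext this
  · refine List.ext_getElem (by rw [length_upperBlocks, h.length_upper]) fun z h₁ h₂ => ?_
    rw [length_upperBlocks] at h₁
    have := fillEntry_succ hk hi X C (y := z) (by omega)
    rw [List.getD_eq_getElem _ _ h₂] at this
    rw [getElem_upperBlocks]
    exact funext this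

end Tableaux

/-! ### Movable blocks are unmarked records -/

section FixedPoints

variable {k n i : ℕ}

/-- The marked words which belong to the tableaux of shape `SH(i)`. -/
structure IsTableauWord (k n i : ℕ) (l : List ((Fin k → ℕ) × Bool)) : Prop where
  isMarkedWord : IsMarkedWord BlockLT l
  head : ∃ x l', l = (x, true) :: l'
  length_marked : (marked l).length = i + 1
  length_unmarked : (unmarked l).length = n - 1 - i
  good : ∀ p ∈ l, IsGoodBlock p.1

/-- The word of all blocks of a tableau, in which those of the first column are marked. -/
noncomputable def blockWord (T : SkewSSYT (SH k n i)) : List ((Fin k → ℕ) × Bool) :=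
  shuffle BlockLT (firstBlocks T) (upperBlocks T)

@[simp] theorem marked_blockWord (T : SkewSSYT (SH k n i)) :
    marked (blockWord T) = firstBlocks T := marked_shuffle _ _

@[simp] theorem unmarked_blockWord (T : SkewSSYT (SH k n i)) :
    unmarked (blockWord T) = upperBlocks T := unmarked_shuffle _ _

theorem blockLT_not_symm (hk : 1 ≤ k) (a b : Fin k → ℕ) (h : BlockLT a b) : ¬ BlockLT b a :=
  h.not_symm hk

theorem blockLT_trans (hk : 1 ≤ k) (a b c : Fin k → ℕ) (h : BlockLT a b) (h' : BlockLT b c) :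
    BlockLT a c := h.trans hk h'

theorem isTableauWord_blockWord (hk : 1 ≤ k) (hi : i < n) (T : SkewSSYT (SH k n i)) :
    IsTableauWord k n i (blockWord T) := by
  have h := isTableauPair hk hi T
  obtain ⟨x, X, hX⟩ := List.exists_cons_of_length_eq_add_one h.length_first
  have hd := h.noDescent
  rw [hX, List.take_succ_cons, List.take_zero, List.singleton_append, NoDescent,
    List.isChain_cons] at hd
  refine ⟨isMarkedWord_shuffle (blockLT_not_symm hk) (blockLT_trans hk) h.chain hd.2, ?_, ?_, ?_, ?_⟩
  -- The first upper-right block is not smaller than the top block, so the shuffle begins with the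
  -- top block, which is marked.
  · rw [blockWord, hX]
    rcases hC : upperBlocks T with _ | ⟨c, C⟩
    · exact ⟨x, _, by rw [shuffle, List.map_cons]⟩
    · exact ⟨x, _, by rw [shuffle, if_neg (hd.1 c (by rw [hC]; rfl))]⟩
  · rw [marked_blockWord, h.length_first]
  · rw [unmarked_blockWord, h.length_upper]
  · rintro ⟨b, _ | _⟩ hb
    · rw [← mem_unmarked, unmarked_blockWord] at hb
      exact h.good_upper b hb
    · rw [← mem_marked, marked_blockWord] at hb
      exact h.good_first b hb

theorem exists_blockWord_eq (hk : 1 ≤ k) (hi : i < n) {l : List ((Fin k → ℕ) × Bool)}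
    (h : IsTableauWord k n i l) : ∃ T : SkewSSYT (SH k n i), blockWord T = l := by
  have hp : IsTableauPair k n i (marked l) (unmarked l) :=
    { length_first := h.length_marked
      length_upper := h.length_unmarked
      good_first := fun b hb => h.good _ (mem_marked.1 hb)
      good_upper := fun b hb => h.good _ (mem_unmarked.1 hb)
      chain := h.isMarkedWord.pairwise_marked
      noDescent := by
        obtain ⟨x, l', rfl⟩ := h.head
        simp only [marked_cons_true, List.take_succ_cons, List.take_zero, List.singleton_append,
          NoDescent, unmarked_cons_true, List.isChain_cons]
        exact ⟨fun c hc => h.isMarkedWord.not_lt_head (blockLT_trans hk) hc,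
          h.isMarkedWord.tail.noDescent_unmarked (blockLT_trans hk)⟩ }
  obtain ⟨T, h₁, h₂⟩ := exists_tableau hk hi hp
  exact ⟨T, by rw [blockWord, h₁, h₂, shuffle_marked_unmarked (blockLT_trans hk) h.isMarkedWord]⟩

theorem insertIdx_length_append {α : Type*} (L₁ L₂ : List α) (x : α) :
    (L₁ ++ L₂).insertIdx L₁.length x = L₁ ++ x :: L₂ := by
  induction L₁ with
  | nil => simp
  | cons a L₁ ih => simpa using ih

theorem eraseIdx_length_append {α : Type*} (L₁ L₂ : List α) (x : α) :
    (L₁ ++ x :: L₂).eraseIdx L₁.length = L₁ ++ L₂ := by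
  induction L₁ with
  | nil => simp
  | cons a L₁ ih => simpa using ih

variable {T : SkewSSYT (SH k n (i + 1))} {l₁ l₂ : List ((Fin k → ℕ) × Bool)} {x : Fin k → ℕ}

theorem firstBlock_of_blockWord (h : blockWord T = l₁ ++ (x, true) :: l₂) :
    firstBlock T (marked l₁).length = x := by
  have h1 : firstBlocks T = marked l₁ ++ x :: marked l₂ := by
    rw [← marked_blockWord, h]
    simp
  rw [← getElem_firstBlocks T (by rw [h1]; simp)]
  simp [h1]

/-- Erasing a mark leaves the word unchanged: the block leaves the first column and enters the
upper-right region at the place determined by the unmarked letters before it. -/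
theorem placedAt_of_blockWord (h : blockWord T = l₁ ++ (x, true) :: l₂)
    {P : SkewSSYT (SH k n i)} (hP : blockWord P = l₁ ++ (x, false) :: l₂) :
    PlacedAt T (marked l₁).length (unmarked l₁).length P := by
  constructor
  · rw [← marked_blockWord, ← marked_blockWord, h, hP]
    simp [eraseIdx_length_append]
  · rw [firstBlock_of_blockWord h, ← unmarked_blockWord, ← unmarked_blockWord, h, hP]
    simp [insertIdx_length_append]

/-- A marked x exceeds every earlier letter, so inserting it directly before an earlier unmarked
letter creates a descent. Together with `placedAt_of_blockWord` this identifies the insertion place.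
-/
theorem not_placedAt_of_lt (hk : 1 ≤ k) (hi : i + 1 < n)
    (h : blockWord T = l₁ ++ (x, true) :: l₂) {j : ℕ} (hj : j < (unmarked l₁).length)
    (P : SkewSSYT (SH k n i)) : ¬ PlacedAt T (marked l₁).length j P := by
  rintro ⟨-, hu⟩
  rw [firstBlock_of_blockWord h, ← unmarked_blockWord T, h, unmarked_append,
    unmarked_cons_true] at hu
  have hsplit : unmarked l₁ ++ unmarked l₂ = (unmarked l₁).take j ++
      ((unmarked l₁)[j] :: ((unmarked l₁).drop (j + 1) ++ unmarked l₂)) := by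
    rw [← List.cons_append, ← List.append_assoc, List.getElem_cons_drop, List.take_append_drop]
  have hlen : ((unmarked l₁).take j).length = j := by
    rw [List.length_take]
    omega
  rw [hsplit] at hu
  conv at hu =>
    rhs
    arg 2
    rw [← hlen]
  rw [insertIdx_length_append] at hu
  have hd := (isTableauPair hk (by omega) P).noDescent
  rw [hu, NoDescent, ← List.append_assoc] at hd
  have hd2 := (List.isChain_append.1 hd).2.1
  refine (List.isChain_cons_cons.1 hd2).1 ?_
  have hm := (isTableauWord_blockWord hk hi T).isMarkedWord
  rw [h] at hm
  exact hm.lt_of_mem (mem_unmarked.1 (List.getElem_mem hj))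

theorem isFixedPoint_iff (hk : 1 ≤ k) (hi : i < n) (P : SkewSSYT (SH k n i)) :
    IsFixedPoint P ↔
      recordSet BlockLT ((blockWord P).map Prod.fst) ⊆ markSet (blockWord P) := by
  have hPw := isTableauWord_blockWord hk hi P
  rw [recordSet_subset_markSet_iff BlockLT]
  constructor
  · rintro hfix l₁ x l₂ hl hx
    -- The first letter is marked, so the unmarked record x stands below the top block once it is
    -- marked; this gives the required position b ≥ 1.
    have hne : l₁ ≠ [] := by
      rintro rfl
      obtain ⟨y, l', hl'⟩ := hPw.head
      simp [hl'] at hl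
    obtain ⟨p, l₁, rfl⟩ := List.exists_cons_of_ne_nil hne
    obtain ⟨y, l', hl'⟩ := hPw.head
    obtain rfl : p = (y, true) := by
      rw [hl', List.cons_append, List.cons.injEq] at hl
      exact hl.1.symm
    have hm := hPw.length_marked
    have hu := hPw.length_unmarked
    rw [hl] at hm hu
    simp only [List.cons_append, marked_cons_true, marked_append, marked_cons_false,
      List.length_cons, List.length_append, unmarked_cons_true, unmarked_append,
      unmarked_cons_false] at hm hu
    have hw : IsTableauWord k n (i + 1) ((y, true) :: l₁ ++ (x, true) :: l₂) := by
      refine ⟨(hl ▸ hPw.isMarkedWord).add_mark hx, ⟨y, _, rfl⟩, ?_, ?_, ?_⟩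
      · simp only [List.cons_append, marked_cons_true, marked_append, List.length_cons,
          List.length_append]
        omega
      · simp only [List.cons_append, unmarked_cons_true, unmarked_append, List.length_append]
        omega
      · have hg := hPw.good
        rw [hl] at hg
        intro q hq
        rcases List.mem_append.1 hq with hq | hq
        · exact hg q (List.mem_append_left _ hq)
        · rcases List.mem_cons.1 hq with rfl | hq
          · exact hg (x, false) (by simp)
          · exact hg q (by simp [hq])
    have hi' : i + 1 < n := by omega
    obtain ⟨T, hT⟩ := exists_blockWord_eq hk hi' hw
    refine hfix (unmarked ((y, true) :: l₁)).length ?_ ⟨T, (marked ((y, true) :: l₁)).length, ?_, ?_,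
      placedAt_of_blockWord hT hl, fun j hj P' => not_placedAt_of_lt hk hi' hT hj P'⟩
    · rw [unmarked_cons_true]
      omega
    · simp
    · rw [marked_cons_true, List.length_cons]
      omega
  · rintro h j hj ⟨T, b, hb1, hb2, hplace, hmin⟩
    have hi' : i + 1 < n := by omega
    have hTw := isTableauWord_blockWord hk hi' T
    have hlen : b < (marked (blockWord T)).length := by
      rw [hTw.length_marked]
      omega
    obtain ⟨l₁, l₂, hl, hb⟩ := exists_split_at_marked hlen
    generalize (marked (blockWord T))[b] = x at hl
    have hm := hTw.length_marked
    have hu := hTw.length_unmarked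
    have hh := hTw.head
    rw [hl] at hm hu hh
    simp only [marked_cons_true, marked_append, List.length_cons, List.length_append,
      unmarked_cons_true, unmarked_append] at hm hu
    have hw : IsTableauWord k n i (l₁ ++ (x, false) :: l₂) := by
      refine ⟨(hl ▸ hTw.isMarkedWord).erase_mark, ?_, ?_, ?_, ?_⟩
      · cases l₁ with
        | nil =>
          simp at hb
          omega
        | cons p l₁ =>
          obtain ⟨y, l', hl'⟩ := hh
          rw [List.cons_append, List.cons.injEq] at hl'
          exact ⟨y, _, by rw [hl'.1, List.cons_append]⟩
      · simp only [marked_append, marked_cons_false, List.length_append]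
        omega
      · simp only [unmarked_append, unmarked_cons_false, List.length_cons, List.length_append]
        omega
      · have hg := hTw.good
        rw [hl] at hg
        intro q hq
        rcases List.mem_append.1 hq with hq | hq
        · exact hg q (List.mem_append_left _ hq)
        · rcases List.mem_cons.1 hq with rfl | hq
          · exact hg (x, true) (by simp)
          · exact hg q (by simp [hq])
    obtain ⟨Q, hQ⟩ := exists_blockWord_eq hk hi hw
    have hQp := placedAt_of_blockWord hl hQ
    rw [hb] at hQp
    -- An earlier place is not semistandard, and a later one contradicts minimality because Q
    -- realizes this place.
    have hjj : j = (unmarked l₁).length := by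
      rcases lt_trichotomy j (unmarked l₁).length with hlt | heq | hgt
      · exact absurd hplace (hb ▸ not_placedAt_of_lt hk hi' hl hlt P)
      · exact heq
      · exact absurd hQp (hmin _ hgt Q)
    have hPQ : P = Q := by
      subst hjj
      exact tableau_ext hk hi (hplace.1.trans hQp.1.symm) (hplace.2.trans hQp.2.symm)
    have hmark := hTw.isMarkedWord
    rw [hl] at hmark
    exact h l₁ x l₂ (hPQ ▸ hQ) fun p hp => hmark.lt_of_mem hp

end FixedPoints

/-! ### Counting fixed points by words of given content -/

section Counting

open Finset

variable {k n i N : ℕ}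

/-- The number of times a value occurs in a list of blocks. -/
def blockCount (L : List (Fin k → ℕ)) (v : ℕ) : ℕ :=
  (L.map fun b => (univ.filter fun p => b p = v).card).sum

/-- The cells of `SH(i)`, listed block by block. -/
def cellOf (k n i : ℕ) : (Fin (i + 1) × Fin k) ⊕ (Fin (n - 1 - i) × Fin k) → ℕ × ℕ :=
  Sum.elim (fun bp => (shTop k n i 0 + k * bp.1 + bp.2, 0))
    (fun jp => (shTop k n i (jp.1 + 1) + jp.2, jp.1 + 1))

theorem cellOf_injective (k n i : ℕ) : Function.Injective (cellOf k n i) := by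
  rintro (⟨b, p⟩ | ⟨b, p⟩) (⟨c, q⟩ | ⟨c, q⟩) h <;>
    simp only [cellOf, Sum.elim_inl, Sum.elim_inr, Prod.mk.injEq] at h
  · have h1 : finProdFinEquiv (b, p) = finProdFinEquiv (c, q) := by
      ext
      simp only [finProdFinEquiv_apply_val]
      omega
    rw [finProdFinEquiv.injective h1]
  · omega
  · omega
  · obtain rfl : b = c := Fin.ext (by omega)
    obtain rfl : p = q := Fin.ext (by omega)
    rfl

theorem map_cellOf (hk : 1 ≤ k) (hi : i < n) :
    univ.map ⟨cellOf k n i, cellOf_injective k n i⟩ = SH k n i := by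
  ext ⟨x, y⟩
  simp only [mem_map, mem_univ, true_and, Function.Embedding.coeFn_mk]
  constructor
  · rintro ⟨⟨b, p⟩ | ⟨b, p⟩, h⟩ <;> rw [← h]
    · have := mem_SH_zero (k := k) hi (mul_add_lt_mul b p)
      rw [← add_assoc] at this
      exact this
    · exact mem_SH_column hi (by have := b.2; omega) p.2
  · intro h
    rcases cell_cases hk hi h with ⟨b, hb, p, rfl, rfl⟩ | ⟨z, hz, p, rfl, rfl⟩
    · exact ⟨Sum.inl (⟨b, hb⟩, p), rfl⟩
    · exact ⟨Sum.inr (⟨z, by omega⟩, p), rfl⟩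

theorem sum_SH (hk : 1 ≤ k) (hi : i < n) (g : ℕ × ℕ → ℕ) :
    ∑ x ∈ SH k n i, g x
      = ∑ b : Fin (i + 1), ∑ p : Fin k, g (shTop k n i 0 + k * b + p, 0)
        + ∑ j : Fin (n - 1 - i), ∑ p : Fin k, g (shTop k n i (j + 1) + p, j + 1) := by
  rw [← map_cellOf hk hi, sum_map, Fintype.sum_sum_type, Fintype.sum_prod_type,
    Fintype.sum_prod_type]
  rfl

theorem blockCount_perm {L L' : List (Fin k → ℕ)} (h : L.Perm L') (v : ℕ) :
    blockCount L v = blockCount L' v :=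
  (h.map _).sum_eq

theorem card_filter_entry_eq (hk : 1 ≤ k) (hi : i < n) (T : SkewSSYT (SH k n i)) (v : ℕ) :
    ((SH k n i).filter (fun x => T.entry x.1 x.2 = v)).card
      = blockCount ((blockWord T).map Prod.fst) v := by
  rw [← blockCount_perm (perm_marked_append_unmarked (blockWord T)), marked_blockWord,
    unmarked_blockWord, blockCount, List.map_append, List.sum_append, firstBlocks, upperBlocks,
    List.map_ofFn, List.map_ofFn, List.sum_ofFn, List.sum_ofFn, card_filter,
    sum_SH hk hi (fun x => if T.entry x.1 x.2 = v then 1 else 0)]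
  simp only [Function.comp_apply, card_filter]
  rfl

/-- The block of positive integers which belongs to a block of letters. -/
def liftBlock (b : Fin k ↪o Fin N) : Fin k → ℕ := fun p => b p + 1

theorem liftBlock_injective : Function.Injective (liftBlock (k := k) (N := N)) := by
  intro b c h
  ext p
  have := congrFun h p
  simpa [liftBlock] using this

theorem blockLT_liftBlock {b c : Fin k ↪o Fin N} :
    BlockLT (liftBlock b) (liftBlock c) ↔ SortedBlockLT k N b c :=
  forall₂_congr fun _ _ => Nat.add_lt_add_iff_right

theorem isGoodBlock_liftBlock (b : Fin k ↪o Fin N) : IsGoodBlock (liftBlock b) :=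
  ⟨fun _ _ h => Nat.add_lt_add_right (Fin.lt_def.1 (b.strictMono h)) 1, fun _ => by simp [liftBlock]⟩

theorem exists_liftBlock_eq {b : Fin k → ℕ} (hb : IsGoodBlock b) (hN : ∀ p, b p ≤ N) :
    ∃ c : Fin k ↪o Fin N, liftBlock c = b := by
  refine ⟨OrderEmbedding.ofStrictMono (fun p => ⟨b p - 1, ?_⟩) ?_, ?_⟩
  · have := hb.2 p
    have := hN p
    omega
  · intro p q hpq
    have := hb.2 p
    have := hb.1 hpq
    rw [Fin.lt_def]
    simp only
    omega
  · funext p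
    exact Nat.sub_add_cancel (hb.2 p)

theorem recordSet_map {α β : Type*} {r : α → α → Prop} {s : β → β → Prop} {f : α → β}
    (h : ∀ a b, s (f a) (f b) ↔ r a b) (w : List α) : recordSet s (w.map f) = recordSet r w := by
  ext j
  simp only [recordSet, mem_filter, mem_range, List.length_map, List.getElem?_map,
    Option.map_eq_some_iff, forall_exists_index, and_imp, forall_apply_eq_imp_iff₂, h]

theorem noDescent_map {α β : Type*} {r : α → α → Prop} {s : β → β → Prop} {f : α → β}
    (h : ∀ a b, s (f a) (f b) ↔ r a b) (w : List α) : NoDescent s (w.map f) ↔ NoDescent r w := by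
  simp only [NoDescent, List.isChain_map, h]

theorem blockCount_liftBlock (w : List (Fin k ↪o Fin N)) (v : Fin N) :
    blockCount (w.map liftBlock) (v + 1) = wordContent w v := by
  induction w with
  | nil => rfl
  | cons b w ih =>
    have h1 : wordContent (b :: w) = (∑ p, Finsupp.single (b p) 1) + wordContent w := rfl
    have h2 : blockCount ((b :: w).map liftBlock) (v + 1)
      = (univ.filter fun p => liftBlock b p = v + 1).card + blockCount (w.map liftBlock) (v + 1) :=
      rfl
    rw [h1, h2, ih, Finsupp.add_apply, Finsupp.finsetSum_apply, card_filter]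
    congr 1
    refine sum_congr rfl fun p _ => ?_
    simp [liftBlock, Finsupp.single_apply, Fin.ext_iff]

theorem blockCount_pos {L : List (Fin k → ℕ)} {b : Fin k → ℕ} (hb : b ∈ L) (p : Fin k) :
    0 < blockCount L (b p) := by
  refine lt_of_lt_of_le ?_ (List.le_sum_of_mem (List.mem_map_of_mem hb))
  exact card_pos.2 ⟨p, by simp⟩

theorem blockCount_liftBlock_of_le (w : List (Fin k ↪o Fin N)) {v : ℕ} (hv : N ≤ v) :
    blockCount (w.map liftBlock) (v + 1) = 0 := by
  refine List.sum_eq_zero fun x hx => ?_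
  simp only [List.map_map, List.mem_map, Function.comp_apply] at hx
  obtain ⟨b, -, rfl⟩ := hx
  rw [card_eq_zero, filter_eq_empty_iff]
  intro p _
  have := (b p).2
  simp only [liftBlock]
  omega

theorem getD_sort_eq_zero {m : ℕ} (μ : m.Partition) {v : ℕ} (hv : m ≤ v) :
    (μ.parts.sort (· ≥ ·)).getD v 0 = 0 := by
  rw [List.getD_eq_default]
  simpa using (card_parts_le μ).trans hv

theorem blockCount_eq_iff {m : ℕ} (μ : m.Partition) (w : List (Fin k ↪o Fin m)) :
    (∀ v, blockCount (w.map liftBlock) (v + 1) = (μ.parts.sort (· ≥ ·)).getD v 0)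
      ↔ wordContent w = partVec m μ := by
  constructor
  · intro h
    ext v
    rw [← blockCount_liftBlock, h, partVec_apply]
  · intro h v
    by_cases hv : v < m
    · rw [← partVec_apply m μ ⟨v, hv⟩, ← h, ← blockCount_liftBlock]
    · rw [blockCount_liftBlock_of_le w (not_lt.1 hv), getD_sort_eq_zero μ (not_lt.1 hv)]

theorem IsFixedPoint.markSet_eq (hk : 1 ≤ k) (hi : i < n) {P : SkewSSYT (SH k n i)}
    (h : IsFixedPoint P) :
    markSet (blockWord P) = recordSet BlockLT ((blockWord P).map Prod.fst) :=
  subset_antisymm ((isMarkedWord_iff BlockLT).1 (isTableauWord_blockWord hk hi P).isMarkedWord).2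
    ((isFixedPoint_iff hk hi P).1 h)

-- In a fixed point the marks are exactly the records, so the underlying word determines the
-- tableau; conversely, marking all records of a word with i + 1 records yields a tableau of shape
-- `SH(i)`.
open Classical in
theorem card_fixedPoints (hk : 1 ≤ k) (hi : i < n) (μ : (k * n).Partition) :
    Nat.card {P : SkewSSYT (SH k n i) // P.HasContent μ ∧ IsFixedPoint P}
      = ((noDescentWords (SortedBlockLT k (k * n)) n).filter fun w =>
          wordContent w = partVec (k * n) μ ∧
            (recordSet (SortedBlockLT k (k * n)) w).card = i + 1).card := by
  set W := (noDescentWords (SortedBlockLT k (k * n)) n).filter fun w =>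
          wordContent w = partVec (k * n) μ ∧
            (recordSet (SortedBlockLT k (k * n)) w).card = i + 1 with hW
  let A : Set (SkewSSYT (SH k n i)) := {P | P.HasContent μ ∧ IsFixedPoint P}
  let f : SkewSSYT (SH k n i) → List (Fin k → ℕ) := fun P => (blockWord P).map Prod.fst
  have hf : Set.InjOn f A := by
    rintro P ⟨-, hP⟩ Q ⟨-, hQ⟩ h
    have h1 : blockWord P = blockWord Q := by
      rw [← setMarks_markSet (blockWord P), ← setMarks_markSet (blockWord Q), hP.markSet_eq hk hi,
        hQ.markSet_eq hk hi]
      exact congrArg (fun w => setMarks w (recordSet BlockLT w)) h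
    refine tableau_ext hk hi ?_ ?_
    · rw [← marked_blockWord, h1, marked_blockWord]
    · rw [← unmarked_blockWord, h1, unmarked_blockWord]
  have himage : f '' A = (List.map liftBlock) '' (W : Set (List (Fin k ↪o Fin (k * n)))) := by
    ext L
    constructor
    · rintro ⟨P, ⟨hc, hP⟩, rfl⟩
      have hw := isTableauWord_blockWord hk hi P
      have hc' : ∀ v, blockCount (f P) (v + 1) = (μ.parts.sort (· ≥ ·)).getD v 0 := by
        intro v
        rw [← hc v, card_filter_entry_eq hk hi]
      have hex : ∀ b ∈ f P, ∃ c : Fin k ↪o Fin (k * n), liftBlock c = b := by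
        intro b hb
        have hgood : IsGoodBlock b := by
          obtain ⟨p, hp, rfl⟩ := List.mem_map.1 hb
          exact hw.good p hp
        refine exists_liftBlock_eq hgood fun p => ?_
        -- An entry larger than kn would occur with positive multiplicity, but a partition of kn has
        -- no part of that index.
        by_contra hlt
        have h1 := blockCount_pos hb p
        obtain ⟨v, hv⟩ : ∃ v, b p = v + 1 := ⟨b p - 1, by omega⟩
        rw [hv, hc', getD_sort_eq_zero μ (by omega)] at h1
        exact lt_irrefl 0 h1
      obtain ⟨w, hwf⟩ : ∃ w : List (Fin k ↪o Fin (k * n)), w.map liftBlock = f P := by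
        have : f P ∈ Set.range (List.map (liftBlock (k := k) (N := k * n))) := by
          rw [Set.range_list_map]
          exact hex
        exact this
      refine ⟨w, ?_, hwf⟩
      rw [hW, mem_coe, mem_filter, noDescentWords, mem_filter, mem_wordsOfLength]
      refine ⟨⟨?_, ?_⟩, ?_, ?_⟩
      · have h1 := congrArg List.length hwf
        have h2 := length_marked_add_length_unmarked (blockWord P)
        rw [hw.length_marked, hw.length_unmarked] at h2
        simp only [f, List.length_map] at h1
        omega
      · rw [← noDescent_map (fun _ _ => blockLT_liftBlock), hwf]
        exact hw.isMarkedWord.noDescent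
      · rw [← blockCount_eq_iff, hwf]
        exact hc'
      · rw [← recordSet_map (fun _ _ => blockLT_liftBlock), hwf, ← hP.markSet_eq hk hi,
          card_markSet, hw.length_marked]
    · rintro ⟨w, hw, rfl⟩
      rw [hW, mem_coe, mem_filter, noDescentWords, mem_filter, mem_wordsOfLength] at hw
      obtain ⟨⟨hlen, hnd⟩, hc, hr⟩ := hw
      set L := w.map liftBlock with hL
      rw [← recordSet_map (fun _ _ => blockLT_liftBlock)] at hr
      rw [← noDescent_map (fun _ _ => blockLT_liftBlock)] at hnd
      rw [← blockCount_eq_iff] at hc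
      have hLlen : L.length = n := by rw [hL, List.length_map, hlen]
      let l := setMarks L (recordSet BlockLT L)
      have hl : l.map Prod.fst = L := map_fst_setMarks _ _
      have hm : markSet l = recordSet BlockLT L :=
        markSet_setMarks fun j hj => lt_length_of_mem_recordSet _ hj
      have hmarked : (marked l).length = i + 1 := by rw [← card_markSet, hm, hr]
      have htw : IsTableauWord k n i l := by
        refine ⟨(isMarkedWord_iff BlockLT).2 ⟨by rw [hl]; exact hnd, by rw [hl, hm]⟩, ?_, hmarked,
          ?_, ?_⟩
        · obtain ⟨b, L', hb⟩ := List.exists_cons_of_length_pos (l := L) (by omega)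
          -- The first letter is vacuously a record, hence marked, and becomes the top block of the
          -- first column.
          have h0 : 0 ∈ recordSet BlockLT L := by
            simp only [recordSet, mem_filter, mem_range]
            exact ⟨by omega, fun _ _ j hj => absurd hj (by simp)⟩
          refine ⟨b, ?_⟩
          simp only [l, setMarks]
          generalize recordSet BlockLT L = S at h0
          rw [hb, List.mapIdx_cons]
          exact ⟨_, by rw [decide_eq_true h0]⟩
        · have h1 := length_marked_add_length_unmarked l
          have h2 := congrArg List.length hl
          rw [List.length_map] at h2
          omega
        · intro p hp
          have : p.1 ∈ L := hl ▸ List.mem_map_of_mem hp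
          obtain ⟨b, -, hb⟩ := List.mem_map.1 this
          rw [← hb]
          exact isGoodBlock_liftBlock b
      obtain ⟨P, hP⟩ := exists_blockWord_eq hk hi htw
      refine ⟨P, ⟨fun v => ?_, ?_⟩, ?_⟩
      · rw [card_filter_entry_eq hk hi, hP, hl]
        exact hc v
      · rw [isFixedPoint_iff hk hi, hP, hl, hm]
      · simp only [f, hP, hl]
  calc Nat.card {P : SkewSSYT (SH k n i) // P.HasContent μ ∧ IsFixedPoint P}
      = A.ncard := rfl
    _ = (f '' A).ncard := hf.ncard_image.symm
    _ = W.card := by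
      rw [himage, Set.ncard_image_of_injective _ (List.map_injective_iff.2 liftBlock_injective),
        Set.ncard_coe_finset]

end Counting
end SymDiv

theorem mainTheorem9 (k n r : ℕ) (hk : 1 ≤ k) (hr : 1 ≤ r) (hrn : r ≤ n)
    (μ : (k * n).Partition) :
    (∃! c : n.Partition → ℚ,
      SymDiv.IsElemExpansion (SymDiv.rowMap k (SymDiv.elemPart μ)) c) ∧
    ∀ c : n.Partition → ℚ,
      SymDiv.IsElemExpansion (SymDiv.rowMap k (SymDiv.elemPart μ)) c →
        (∑ ν : n.Partition with ν.parts.card = r, c ν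
          = (Nat.card {P : SymDiv.SkewSSYT (SymDiv.SH k n (r - 1)) //
              P.HasContent μ ∧ SymDiv.IsFixedPoint P} : ℚ)) ∧
        0 ≤ ∑ ν : n.Partition with ν.parts.card = r, c ν := by
  refine ⟨SymDiv.existsUnique_isElemExpansion hk μ, fun c hc => ?_⟩
  have h : ∑ ν : n.Partition with ν.parts.card = r, c ν
      = (Nat.card {P : SymDiv.SkewSSYT (SymDiv.SH k n (r - 1)) //
          P.HasContent μ ∧ SymDiv.IsFixedPoint P} : ℚ) := by
    rw [SymDiv.card_fixedPoints hk (by omega) μ, Nat.sub_add_cancel hr]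
    convert SymDiv.sum_coeff_eq_card_words hk hc hrn
  exact ⟨h, h ▸ Nat.cast_nonneg _⟩
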